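/- **Definitions.** For $n\ge 1$ agents and $m\ge 3$ objects let $S_m$ be the set of rankings of $[m]$ and $\mathcal R=S_m^n$ the set of profiles. The formula $GS_{n,m}$ has the variables $X_{R,o}$ ($R\in\mathcal R$, $o\in[m]$; "the outcome at $R$ is $o$") and is the conjunction of the clauses - $\bigvee_{o\in[m]}X_{R,o}$ and $\overline{X_{R,o_1}}\vee\overline{X_{R,o_2}}$ for $R\in\mathcal R$ and $o_1\ne o_2$ (each profile has exactly one outcome); - $\bigvee_{R\in\mathcal R}\overline{X_{R,\mathrm{top}(R_i)}}$ for each agent $i$ (no agent is a dictator); - $\bigvee_{R\in\mathcal R}X_{R,o}$ for each $o\in[m]$ (every object is an outcome); - $\overline{X_{R,o}}\vee\bigvee_{o'}X_{R',o'}$ for all $R\in\mathcal R$, $o\in[m]$, agents $i$ and $\pi\in S_m$, where $R'$ is $R$ with $R_i$ replaced by $\pi$, and $o'$ ranges over the objects with $o$ weakly preferred to $o'$ in $R_i$ (strategyproofness). Frege proofs are derivations in a textbook propositional system with finitely many axiom schemes and modus ponens as the only rule. Sizes of formulas and of proofs are total numbers of symbols, and $|GS_{n,m}|$ is the size of $GS_{n,m}$.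 A Frege proof of the unsatisfiability of a formula is a derivation of $\bot$ from its clauses. Let $L$ be the parameterized problem of all pairs $(n,m)$, written in unary and with parameter $n$, such that $n\ge1$, $m\ge3$ and $GS_{n,m}$ is unsatisfiable. Consider the rules - (A) $(n,m)\mapsto(n,3)$ if $m\ge4$ (restrict to three objects); - (B) $(n,m)\mapsto(n-1,m)$ if $n\ge3$ and $m\ge3$ (remove an agent), each acting as the identity otherwise. A *data reduction chain* for $x$ is a sequence $x=x_0,x_1,\dots,x_\ell$ in which every $x_{j+1}$ is obtained from $x_j$ by one of the rules and $x_\ell$ is fixed by both rules; $\ell$ is its length. **Theorem.** (A) and (B) are data reduction rules for $L$: they are computable in polynomial time by a Turing machine, they preserve membership and non-membership in $L$, and they do not increase the length of the instance. They yield a kernelization of $L$, namely the polynomial-time map that sends $(n,m)$ to $(\min(n,2),3)$ if $m\ge3$ and to itself otherwise; it preserves membership and non-membership in $L$, and the length and the parameter of its value are bounded by a computable function of the parameter. Moreover: 1. There is a constant $C$, independent of $n$ and $m$, such that for all $n\ge1$, $m\ge3$ the pair $(n,m)$ has a data reduction chain of length at most $Cn$, every data reduction chain for $(n,m)$ ends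 in the kernel $(\min(n,2),3)$, and every such chain in which each step changes the instance has length at most $Cn$. 2. The soundness of the steps has polynomial-size Frege proofs: there are a constant $R$ and a polynomial $p$ such that for all $n\ge1$, $m\ge3$ and every step $(n_j,m_j)\to(n_{j+1},m_{j+1})$ of a data reduction chain for $(n,m)$ there are $r\le R$ formulas $\Xi_1,\dots,\Xi_r$ in the variables of $GS_{n_j,m_j}$, and substitutions $\sigma_1,\dots,\sigma_r$ of such formulas for the variables of $GS_{n_{j+1},m_{j+1}}$, together with a Frege proof of $\Xi_1\vee\dots\vee\Xi_r$ and, for each $t\le r$, a Frege derivation of all the clauses of $\sigma_t(GS_{n_{j+1},m_{j+1}})$ from the clauses of $GS_{n_j,m_j}$ and $\Xi_t$, of total size at most $p(|GS_{n,m}|)$. Hence: - (a) there is a function $f(s)=2^{O(\log^k s)}$, for some $k>0$, such that for all $n\ge1$, $m\ge3$ there is a Frege proof of size at most $f(|GS_{n,m}|)$ of the unsatisfiability of $GS_{n,m}$; - (b) for every $n\ge1$ there is a polynomial $p_n$ such that for every $m\ge3$ there is a Frege proof of size at most $p_n(|GS_{n,m}|)$ of the unsatisfiability of $GS_{n,m}$.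 -/

import Mathlib

/-! ### Propositional formulas and a Frege system -/

/-- Propositional formulas over the variables `V`, in the basis `⊥, ¬, ∧, ∨, →`. -/
inductive PropForm (V : Type) : Type where
  | var (x : V) : PropForm V
  | bot : PropForm V
  | neg (A : PropForm V) : PropForm V
  | conj (A B : PropForm V) : PropForm V
  | disj (A B : PropForm V) : PropForm V
  | imp (A B : PropForm V) : PropForm V

namespace PropForm

/-- Truth of a formula under an assignment of truth values. -/
def eval {V : Type} (v : V → Prop) : PropForm V → Prop
  | var x => v x
  | bot => False
  | neg A => ¬ A.eval v
  | conj A B => A.eval v ∧ B.eval v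
  | disj A B => A.eval v ∨ B.eval v
  | imp A B => A.eval v → B.eval v

/-- The size of a formula: its number of symbols (occurrences of variables and connectives). -/
def size {V : Type} : PropForm V → ℕ
  | var _ => 1
  | bot => 1
  | neg A => A.size + 1
  | conj A B => A.size + B.size + 1
  | disj A B => A.size + B.size + 1
  | imp A B => A.size + B.size + 1

/-- Simultaneous substitution of formulas for variables. -/
def subst {V W : Type} (s : W → PropForm V) : PropForm W → PropForm V
  | var x => s x
  | bot => bot
  | neg A => neg (A.subst s)
  | conj A B => conj (A.subst s) (B.subst s)
  | disj A B => disj (A.subst s) (B.subst s)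
  | imp A B => imp (A.subst s) (B.subst s)

/-- The disjunction of a list of formulas; the empty disjunction is `⊥`. -/
def bigDisj {V : Type} : List (PropForm V) → PropForm V
  | [] => bot
  | A :: l => disj A (bigDisj l)

end PropForm

/-- The axiom schemes of a textbook Frege system whose only rule is modus ponens. -/
inductive FregeAxiom {V : Type} : PropForm V → Prop where
  | k (A B : PropForm V) : FregeAxiom (.imp A (.imp B A))
  | s (A B C : PropForm V) :
      FregeAxiom (.imp (.imp A (.imp B C)) (.imp (.imp A B) (.imp A C)))
  | andLeft (A B : PropForm V) : FregeAxiom (.imp (.conj A B) A)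
  | andRight (A B : PropForm V) : FregeAxiom (.imp (.conj A B) B)
  | andIntro (A B : PropForm V) : FregeAxiom (.imp A (.imp B (.conj A B)))
  | orLeft (A B : PropForm V) : FregeAxiom (.imp A (.disj A B))
  | orRight (A B : PropForm V) : FregeAxiom (.imp B (.disj A B))
  | orElim (A B C : PropForm V) :
      FregeAxiom (.imp (.imp A C) (.imp (.imp B C) (.imp (.disj A B) C)))
  | negIntro (A B : PropForm V) :
      FregeAxiom (.imp (.imp A B) (.imp (.imp A (.neg B)) (.neg A)))
  | negElim (A : PropForm V) : FregeAxiom (.imp (.neg (.neg A)) A)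
  | exFalso (A : PropForm V) : FregeAxiom (.imp .bot A)

/-- `IsFregeDerivation Γ P`: the list `P` of formulas, whose lines are listed with the latest
one first, is a Frege derivation from the hypotheses `Γ`: every line is an instance of an axiom
scheme, or a hypothesis, or follows from two earlier lines by modus ponens. -/
def IsFregeDerivation {V : Type} (Γ : Set (PropForm V)) : List (PropForm V) → Prop
  | [] => True
  | A :: P =>
      (FregeAxiom A ∨ A ∈ Γ ∨ ∃ B ∈ P, PropForm.imp B A ∈ P) ∧ IsFregeDerivation Γ P

/-- The total number of symbols of a list of formulas. It is used both as the size `|Φ|` of a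
formula given as a conjunction of a list of clauses, and as the size of a Frege derivation. -/
def totalSize {V : Type} (P : List (PropForm V)) : ℕ := (P.map PropForm.size).sum

/-- The conjunction of the list `Φ` has no satisfying assignment. -/
def Unsat {V : Type} (Φ : List (PropForm V)) : Prop :=
  ¬ ∃ v : V → Prop, ∀ A ∈ Φ, A.eval v

/-- A Frege proof of the unsatisfiability of `Φ`: a Frege derivation of `⊥` in which the clauses
of `Φ` may be used as axioms. -/
def IsFregeRefutation {V : Type} (Φ : List (PropForm V)) (P : List (PropForm V)) : Prop :=
  IsFregeDerivation {A | A ∈ Φ} P ∧ PropForm.bot ∈ P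

/-- The soundness of the step from `Φ` to `Ψ` has Frege proofs of total size at most `N`, by an
argument with at most `R` cases: there are cases `Ξ 0, …, Ξ (r - 1)` with `r ≤ R`, a Frege proof
of their disjunction, and for each case `t` a substitution `s t` of formulas in the variables of
`Φ` for the variables of `Ψ`, together with a Frege derivation of all the clauses of `Ψ`
under this substitution from the clauses of `Φ` and `Ξ t`. -/
def StepFregeSound {V W : Type} (R : ℕ) (Φ : List (PropForm V)) (Ψ : List (PropForm W))
    (N : ℕ) : Prop :=
  ∃ r ≤ R, ∃ (Ξ : Fin r → PropForm V) (s : Fin r → W → PropForm V)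
    (P : List (PropForm V)) (Q : Fin r → List (PropForm V)),
    (IsFregeDerivation ∅ P ∧ PropForm.bigDisj (List.ofFn Ξ) ∈ P) ∧
    (∀ t, IsFregeDerivation ({A | A ∈ Φ} ∪ {Ξ t}) (Q t) ∧ ∀ B ∈ Ψ, B.subst (s t) ∈ Q t) ∧
    totalSize P + ∑ t, totalSize (Q t) ≤ N

/-- `f` is quasipolynomial: `f(s) = O(2 ^ (c * (log s) ^ k))` for some `c` and some `k > 0`. -/
def IsQuasipolynomial (f : ℕ → ℕ) : Prop :=
  ∃ (k : ℕ) (c : ℝ), 0 < k ∧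
    (fun s : ℕ => (f s : ℝ)) =O[Filter.atTop] fun s : ℕ => (2 : ℝ) ^ (c * Real.log s ^ k)

/-! ### Data reduction and kernelization

A parameterized problem is a set `L` of instances, where instances are encoded as words by `e`
and `κ x` is the parameter of the instance `x`. -/

/-- A data reduction rule for `L`: a polynomial-time map on instances that is safe and does not
increase the length of the instance. -/
structure IsDataReductionRule {I S : Type} (e : Computability.Encoding I S) (L : Set I)
    (A : I → I) : Prop where
  polyTime : Nonempty (Turing.TM2ComputableInPolyTime e.encode e.encode A)
  safe : ∀ x, x ∈ L ↔ A x ∈ L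
  length_le : ∀ x, (e.encode (A x)).length ≤ (e.encode x).length

/-- A kernelization of `L`: a polynomial-time map to equivalent instances whose length and
parameter are bounded by a computable function of the parameter of the given instance. -/
structure IsKernelization {I S : Type} (e : Computability.Encoding I S) (κ : I → ℕ) (L : Set I)
    (K : I → I) : Prop where
  polyTime : Nonempty (Turing.TM2ComputableInPolyTime e.encode e.encode K)
  safe : ∀ x, x ∈ L ↔ K x ∈ L
  bounded : ∃ g : ℕ → ℕ, Computable g ∧
    ∀ x, (e.encode (K x)).length ≤ g (κ x) ∧ κ (K x) ≤ g (κ x)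

/-- `c 0, …, c ℓ` is a data reduction chain (of length `ℓ`) for the instance `x` with respect to
the given rules: it starts at `x`, each step applies one of the rules, and no rule changes the
last instance. -/
def IsReductionChain {I : Type} (rules : List (I → I)) (x : I) (ℓ : ℕ) (c : Fin (ℓ + 1) → I) :
    Prop :=
  c 0 = x ∧ (∀ i : Fin ℓ, ∃ A ∈ rules, c i.succ = A (c i.castSucc)) ∧
    ∀ A ∈ rules, A (c (Fin.last ℓ)) = c (Fin.last ℓ)

/-! ### The Gibbard–Satterthwaite formulas -/

/-- Profiles of `n` agents over `m` objects. The ranking of agent `i` is the permutation `R i`,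
with `R i j` the object in position `j`, so that `(R i).symm o` is the position of object `o`
and lower positions are preferred. -/
abbrev GSProfile (n m : ℕ) : Type := Fin n → Equiv.Perm (Fin m)

/-- The variable `(R, o)` stands for "the outcome at profile `R` is `o`". -/
abbrev GSVar (n m : ℕ) : Type := GSProfile n m × Fin m

noncomputable section

/-- All profiles, in some order. -/
def gsProfiles (n m : ℕ) : List (GSProfile n m) := (Finset.univ : Finset (GSProfile n m)).toList

/-- All rankings, in some order. -/
def gsRankings (m : ℕ) : List (Equiv.Perm (Fin m)) :=
  (Finset.univ : Finset (Equiv.Perm (Fin m))).toList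

/-- `o` is the top object of the ranking `π`: it is preferred to all others. -/
def IsTopObject {m : ℕ} (π : Equiv.Perm (Fin m)) (o : Fin m) : Prop :=
  ∀ o', π.symm o ≤ π.symm o'

/-- Every profile has an outcome. -/
def gsTotal (n m : ℕ) : List (PropForm (GSVar n m)) :=
  (gsProfiles n m).map fun R =>
    PropForm.bigDisj ((List.finRange m).map fun o => .var (R, o))

/-- No profile has two different outcomes. -/
def gsUnique (n m : ℕ) : List (PropForm (GSVar n m)) :=
  (gsProfiles n m).flatMap fun R => (List.finRange m).flatMap fun o₁ =>
    ((List.finRange m).filter fun o₂ => o₁ ≠ o₂).map fun o₂ =>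
      PropForm.bigDisj [.neg (.var (R, o₁)), .neg (.var (R, o₂))]

open Classical in
/-- No agent is a dictator: for each agent `i`, the disjunction over all profiles `R` of
"the outcome at `R` is not the top object of agent `i`". -/
def gsNondict (n m : ℕ) : List (PropForm (GSVar n m)) :=
  (List.finRange n).map fun i =>
    PropForm.bigDisj ((gsProfiles n m).flatMap fun R =>
      ((List.finRange m).filter fun o => IsTopObject (R i) o).map fun o => .neg (.var (R, o)))

/-- Every object is an outcome. -/
def gsOnto (n m : ℕ) : List (PropForm (GSVar n m)) :=
  (List.finRange m).map fun o => PropForm.bigDisj ((gsProfiles n m).map fun R => .var (R, o))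

/-- Strategyproofness: if the outcome at `R` is `o`, then the outcome after agent `i` misreports
`π` is an object to which `i`, according to the ranking `R i`, weakly prefers `o`. -/
def gsStrategyproof (n m : ℕ) : List (PropForm (GSVar n m)) :=
  (gsProfiles n m).flatMap fun R => (List.finRange m).flatMap fun o =>
    (List.finRange n).flatMap fun i => (gsRankings m).map fun π =>
      PropForm.bigDisj (.neg (.var (R, o)) ::
        ((List.finRange m).filter fun o' => (R i).symm o ≤ (R i).symm o').map fun o' =>
          .var (Function.update R i π, o'))

/-- The formula `GS_{n,m}` (`n` agents, `m` objects), as the list of its clauses. -/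
def gsFormula (n m : ℕ) : List (PropForm (GSVar n m)) :=
  gsTotal n m ++ gsUnique n m ++ gsNondict n m ++ gsOnto n m ++ gsStrategyproof n m

end

/-! ### The Gibbard–Satterthwaite problem and its data reduction rules

An instance is a pair `(n, m)` (`n` agents, `m` objects) written in unary, with parameter `n`. -/

/-- The unary encoding of instances; the code of `(n, m)` has length `n + m`. -/
def gsEncoding : Computability.Encoding (ℕ × ℕ) (Bool ⊕ Bool) :=
  Computability.encodingProd Computability.unaryEncodingNat Computability.unaryEncodingNat

/-- The instances with at least one agent and at least three objects whose formula is
unsatisfiable. -/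
def gsProblem : Set (ℕ × ℕ) := {x | 1 ≤ x.1 ∧ 3 ≤ x.2 ∧ Unsat (gsFormula x.1 x.2)}

/-- The first rule: if there are more than three objects, restrict to three of them. -/
def gsRestrictObjects (x : ℕ × ℕ) : ℕ × ℕ := if 4 ≤ x.2 then (x.1, 3) else x

/-- The second rule: if there are at least three agents (and three objects), remove an agent. -/
def gsRemoveAgent (x : ℕ × ℕ) : ℕ × ℕ := if 3 ≤ x.1 ∧ 3 ≤ x.2 then (x.1 - 1, x.2) else x

/-- The list of the two data reduction rules. -/
def gsRules : List (ℕ × ℕ → ℕ × ℕ) := [gsRestrictObjects, gsRemoveAgent]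

/-- The kernel: at most two agents and exactly three objects, for instances with at least three
objects. -/
def gsKernel (x : ℕ × ℕ) : ℕ × ℕ := if 3 ≤ x.2 then (min x.1 2, 3) else x

/-! ### Frege derivations -/

/-! The engine is the Gibbard–Satterthwaite theorem itself, proved by decisive coalitions in a form
that Frege proofs can follow. Write `w = (m!)^n` for the number of profiles. Since `GS_{n,m}` has a
totality clause for each profile, `w` is at most its size (`gsWeight_le_totalSize`), so every
argument that ranges over profiles, pairs of variables, agents or objects costs only a power of `w`.
Each single inference is an instance of one of finitely many fixed schemes, whose derivations exist
by completeness and have constant size (`PolyDer.schema`). Sizes are tracked as exponents of `w`; as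
`w ≥ 2`, constants and sums are absorbed into the exponent.

Strategyproofness gives monotonicity: an outcome survives when nothing overtakes it
(`polyDer_lift`). With surjectivity this yields unanimity and the Pareto principle. A coalition `A`
is decisive for `(a, b)` if `a` wins when `A` ranks `a, b` on top and the others `b, a`. A Condorcet
profile shows that if `A` is decisive for `(a, b)` and `B` for `(b, c)`, then `A ∩ B` is decisive
for `(a, c)` (`polyDer_decisive_inter`); intersecting with the coalition of all agents gives
independence of the pair. A decisive singleton would be a dictator, so complements of singletons are
decisive, and intersecting them all makes `∅` decisive, which contradicts unanimity (`polyDer_bot`).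
This direct refutation has size polynomial in `|GS_{n,m}|`, uniformly in `n` and `m`; both (a) and
(b) follow from it, and `gsProblem` is just `1 ≤ n ∧ 3 ≤ m`, which makes safety of the rules
arithmetic.

For the soundness of a step, a social choice function is restricted to profiles that extend rankings
of fewer objects and in which merged agents agree. All clauses survive this except possibly
non-dictatorship, which needs that no class of merged agents is decisive (`polyDer_restrict`). When
only objects are dropped, the classes are singletons. When an agent is removed, `{0, 1}` and `{1,
2}` cannot both be decisive, since they meet in `{1}`; so one of these pairs can be merged, which
accounts for the two cases. -/

theorem IsFregeDerivation.mono {V : Type} {Γ Γ' : Set (PropForm V)} (h : Γ ⊆ Γ') :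
    ∀ {P : List (PropForm V)}, IsFregeDerivation Γ P → IsFregeDerivation Γ' P
  | [], _ => trivial
  | _ :: _, ⟨h₁, h₂⟩ => ⟨h₁.imp_right (Or.imp_left fun hA => h hA), h₂.mono h⟩

/-- Composition of derivations: `Q` is replayed on top of `P`, and a line that `Q` takes from `Δ` is
dropped if `P` already contains it. Sizes therefore add up, with no multiplicative loss. -/
theorem IsFregeDerivation.append {V : Type} {Γ Δ : Set (PropForm V)} {P : List (PropForm V)}
    (hP : IsFregeDerivation Γ P) (hΔ : ∀ A ∈ Δ, A ∈ Γ ∨ A ∈ P) :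
    ∀ {Q : List (PropForm V)}, IsFregeDerivation Δ Q →
      ∃ Q', IsFregeDerivation Γ (Q' ++ P) ∧ (∀ A ∈ Q, A ∈ Q' ++ P) ∧
        totalSize Q' ≤ totalSize Q
  | [], _ => ⟨[], hP, by simp, le_rfl⟩
  | A :: Q, ⟨h₁, h₂⟩ => by
    obtain ⟨Q', hQ', hmem, hsize⟩ := IsFregeDerivation.append hP hΔ h₂
    have hs : totalSize (A :: Q) = A.size + totalSize Q := by simp [totalSize]
    have hs' : totalSize (A :: Q') = A.size + totalSize Q' := by simp [totalSize]
    have new : (FregeAxiom A ∨ A ∈ Γ ∨ ∃ B ∈ Q' ++ P, PropForm.imp B A ∈ Q' ++ P) →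
        ∃ Q', IsFregeDerivation Γ (Q' ++ P) ∧ (∀ B ∈ A :: Q, B ∈ Q' ++ P) ∧
          totalSize Q' ≤ totalSize (A :: Q) := fun h =>
      ⟨A :: Q', ⟨h, hQ'⟩, by
        simp only [List.cons_append, List.mem_cons]
        exact fun B hB => hB.imp_right (hmem B), by omega⟩
    rcases h₁ with h | h | ⟨B, hB, hBA⟩
    · exact new (Or.inl h)
    · rcases hΔ A h with h | h
      · exact new (Or.inr (Or.inl h))
      · refine ⟨Q', hQ', ?_, by omega⟩
        simp only [List.mem_cons, forall_eq_or_imp]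
        exact ⟨List.mem_append_right _ h, hmem⟩
    · exact new (Or.inr (Or.inr ⟨B, hmem B hB, hmem _ hBA⟩))

theorem FregeAxiom.subst {V W : Type} (s : W → PropForm V) {A : PropForm W} (h : FregeAxiom A) :
    FregeAxiom (A.subst s) := by
  cases h <;> simp only [PropForm.subst] <;> constructor

theorem IsFregeDerivation.subst {V W : Type} (s : W → PropForm V) {Γ : Set (PropForm W)} :
    ∀ {P : List (PropForm W)}, IsFregeDerivation Γ P →
      IsFregeDerivation (PropForm.subst s '' Γ) (P.map (PropForm.subst s))
  | [], _ => trivial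
  | A :: P, ⟨h₁, h₂⟩ => by
    refine ⟨?_, h₂.subst s⟩
    rcases h₁ with h | h | ⟨B, hB, hBA⟩
    · exact Or.inl (h.subst s)
    · exact Or.inr (Or.inl ⟨A, h, rfl⟩)
    · exact Or.inr (Or.inr ⟨B.subst s, List.mem_map_of_mem hB, List.mem_map.2 ⟨_, hBA, rfl⟩⟩)

theorem PropForm.one_le_size {V : Type} (A : PropForm V) : 1 ≤ A.size := by
  cases A <;> simp [PropForm.size]

theorem PropForm.size_subst_le {V W : Type} (s : W → PropForm V) {N : ℕ} (hN : 1 ≤ N)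
    (hs : ∀ x, (s x).size ≤ N) (A : PropForm W) : (A.subst s).size ≤ A.size * N := by
  induction A with
  | var x => simpa [PropForm.subst, PropForm.size] using hs x
  | bot => simpa [PropForm.subst, PropForm.size] using hN
  | neg A ih => simp only [PropForm.subst, PropForm.size]; linarith
  | conj A B ihA ihB => simp only [PropForm.subst, PropForm.size]; linarith
  | disj A B ihA ihB => simp only [PropForm.subst, PropForm.size]; linarith
  | imp A B ihA ihB => simp only [PropForm.subst, PropForm.size]; linarith

theorem totalSize_append {V : Type} (P Q : List (PropForm V)) :
    totalSize (P ++ Q) = totalSize P + totalSize Q := by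
  simp [totalSize]

theorem totalSize_map_subst_le {V W : Type} (s : W → PropForm V) {N : ℕ} (hN : 1 ≤ N)
    (hs : ∀ x, (s x).size ≤ N) (P : List (PropForm W)) :
    totalSize (P.map (PropForm.subst s)) ≤ totalSize P * N := by
  induction P with
  | nil => simp [totalSize]
  | cons A P ih =>
    simp only [totalSize, List.map_cons, List.sum_cons] at ih ⊢
    have := A.size_subst_le s hN hs
    linarith

/-- Soundness of Frege derivations. -/
theorem IsFregeDerivation.sound {V : Type} {Γ : Set (PropForm V)} {v : V → Prop}
    (hv : ∀ A ∈ Γ, A.eval v) :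
    ∀ {P : List (PropForm V)}, IsFregeDerivation Γ P → ∀ A ∈ P, A.eval v
  | [], _, A, hA => by simp at hA
  | B :: P, ⟨h₁, h₂⟩, A, hA => by
    have ih := h₂.sound hv
    rcases List.mem_cons.1 hA with rfl | hA
    · rcases h₁ with h | h | ⟨C, hC, hCA⟩
      · cases h <;> simp only [PropForm.eval] <;> tauto
      · exact hv _ h
      · exact ih _ hCA (ih _ hC)
    · exact ih A hA

theorem IsFregeRefutation.unsat {V : Type} {Φ P : List (PropForm V)}
    (h : IsFregeRefutation Φ P) : Unsat Φ := fun ⟨_, hv⟩ => h.1.sound hv _ h.2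

/-! ### Completeness of the Frege system -/

/-- Derivability in the Frege system, without regard to size. -/
def FregeProvable {V : Type} (Γ : Set (PropForm V)) (A : PropForm V) : Prop :=
  ∃ P, IsFregeDerivation Γ P ∧ A ∈ P

namespace FregeProvable

variable {V : Type} {Γ Γ' : Set (PropForm V)} {A B C : PropForm V}

theorem mono (h : Γ ⊆ Γ') : FregeProvable Γ A → FregeProvable Γ' A
  | ⟨P, hP, hA⟩ => ⟨P, hP.mono h, hA⟩

theorem ax (h : FregeAxiom A) : FregeProvable Γ A := ⟨[A], ⟨Or.inl h, trivial⟩, by simp⟩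

theorem hyp (h : A ∈ Γ) : FregeProvable Γ A := ⟨[A], ⟨Or.inr (Or.inl h), trivial⟩, by simp⟩

theorem mp (h₁ : FregeProvable Γ (.imp A B)) (h₂ : FregeProvable Γ A) : FregeProvable Γ B := by
  obtain ⟨P, hP, hA⟩ := h₁
  obtain ⟨Q, hQ, hB⟩ := h₂
  obtain ⟨Q', hQ', hmem, -⟩ := hP.append (fun A hA => Or.inl hA) hQ
  exact ⟨B :: (Q' ++ P),
    ⟨Or.inr (Or.inr ⟨A, hmem _ hB, List.mem_append_right _ hA⟩), hQ'⟩, by simp⟩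

theorem weaken (h : FregeProvable Γ B) : FregeProvable Γ (.imp A B) := (ax (.k B A)).mp h

theorem imp_self : FregeProvable Γ (.imp A A) :=
  ((ax (.s A (.imp A A) A)).mp (ax (.k _ _))).mp (ax (.k A A))

/-- The deduction theorem. -/
theorem deduction (h : FregeProvable (insert A Γ) B) : FregeProvable Γ (.imp A B) := by
  obtain ⟨P, hP, hB⟩ := h
  induction P generalizing B with
  | nil => simp at hB
  | cons C P ih =>
    rcases List.mem_cons.1 hB with rfl | hB
    · rcases hP.1 with h | h | ⟨D, hD, hDB⟩
      · exact (ax h).weaken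
      · rcases h with rfl | h
        · exact imp_self
        · exact (hyp h).weaken
      · exact ((ax (.s A D B)).mp (ih hP.2 hDB)).mp (ih hP.2 hD)
    · exact ih hP.2 hB

theorem neg_of (h₁ : FregeProvable (insert A Γ) B) (h₂ : FregeProvable (insert A Γ) (.neg B)) :
    FregeProvable Γ (.neg A) :=
  ((ax (.negIntro A B)).mp h₁.deduction).mp h₂.deduction

theorem head : FregeProvable (insert A Γ) A := hyp (Set.mem_insert _ _)

theorem tail (h : FregeProvable Γ A) : FregeProvable (insert B Γ) A := h.mono (Set.subset_insert _ _)

theorem of_neg (h₁ : FregeProvable Γ (.neg A)) (h₂ : FregeProvable Γ A) : FregeProvable Γ B :=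
  (ax (.negElim B)).mp (neg_of h₂.tail h₁.tail)

theorem byCases (h₁ : FregeProvable (insert A Γ) B) (h₂ : FregeProvable (insert (.neg A) Γ) B) :
    FregeProvable Γ B := by
  have h : FregeProvable (insert (.neg B) Γ) (.neg A) :=
    neg_of (B := B) (h₁.mono (Set.insert_subset_insert (Set.subset_insert _ _))) head.tail
  have h' : FregeProvable (insert (.neg B) Γ) (.neg (.neg A)) :=
    neg_of (B := B) (h₂.mono (Set.insert_subset_insert (Set.subset_insert _ _))) head.tail
  exact (ax (.negElim B)).mp (neg_of h h')

end FregeProvable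

/-- The literals over the variables in `s` that are true under `v`. -/
def trueLiterals {V : Type} (s : Set V) (v : V → Prop) : Set (PropForm V) :=
  {L | ∃ x ∈ s, (v x ∧ L = .var x) ∨ (¬ v x ∧ L = .neg (.var x))}

-- Kalmár's lemma, by induction on the formula: the literals of a full assignment decide every
-- formula.
open FregeProvable in
theorem FregeProvable.of_trueLiterals {V : Type} (v : V → Prop) (A : PropForm V) :
    (A.eval v → FregeProvable (trueLiterals Set.univ v) A) ∧
      (¬ A.eval v → FregeProvable (trueLiterals Set.univ v) (.neg A)) := by
  induction A with
  | var x =>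
    exact ⟨fun h => hyp ⟨x, trivial, Or.inl ⟨h, rfl⟩⟩, fun h => hyp ⟨x, trivial, Or.inr ⟨h, rfl⟩⟩⟩
  | bot =>
    refine ⟨fun h => h.elim, fun _ => neg_of (B := .bot) head ?_⟩
    exact (ax (.exFalso _)).mp head
  | neg A ih =>
    refine ⟨ih.2, fun h => ?_⟩
    exact neg_of (B := A) (ih.1 (not_not.1 h)).tail head
  | conj A B ihA ihB =>
    refine ⟨fun h => ((ax (.andIntro A B)).mp (ihA.1 h.1)).mp (ihB.1 h.2), fun h => ?_⟩
    by_cases hA : A.eval v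
    · have hB := ihB.2 fun hB => h ⟨hA, hB⟩
      exact neg_of ((ax (.andRight A B)).mp head) hB.tail
    · exact neg_of ((ax (.andLeft A B)).mp head) (ihA.2 hA).tail
  | disj A B ihA ihB =>
    constructor
    · rintro (h | h)
      · exact (ax (.orLeft A B)).mp (ihA.1 h)
      · exact (ax (.orRight A B)).mp (ihB.1 h)
    · intro h
      have hA := ihA.2 fun hA => h (Or.inl hA)
      have hB := ihB.2 fun hB => h (Or.inr hB)
      have e : FregeProvable (insert (.disj A B) (trueLiterals Set.univ v)) .bot :=
        (((ax (.orElim A B .bot)).mp (deduction (of_neg hA.tail.tail head))).mp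
          (deduction (of_neg hB.tail.tail head))).mp head
      exact neg_of (B := .bot) e ((ax (.exFalso _)).mp e)
  | imp A B ihA ihB =>
    constructor
    · intro h
      by_cases hA : A.eval v
      · exact (ihB.1 (h hA)).weaken
      · exact deduction (of_neg (ihA.2 hA).tail head)
    · intro h
      obtain ⟨hA, hB⟩ := not_forall.1 h
      exact neg_of ((head).mp (ihA.1 hA).tail) (ihB.2 hB).tail

/-- No size bound is needed here, because completeness is applied only to finitely many fixed
schemes. -/
theorem FregeProvable.of_tautology {V : Type} [Fintype V] {A : PropForm V}
    (hA : ∀ v, A.eval v) : FregeProvable ∅ A := by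
  classical
  -- `s` is the set of variables whose literals have been discarded. Kalmár's lemma is the case `s =
  -- ∅`; each further variable is removed by a case distinction on it.
  suffices h : ∀ (s : Finset V) (v : V → Prop), FregeProvable (trueLiterals (↑sᶜ : Set V) v) A by
    refine (h Finset.univ fun _ => True).mono ?_
    rintro L ⟨x, hx, -⟩
    simp at hx
  intro s
  induction s using Finset.induction with
  | empty =>
    intro v
    simpa using (FregeProvable.of_trueLiterals v A).1 (hA v)
  | insert x s hx ih =>
    intro v
    refine FregeProvable.byCases (A := .var x)
      ((ih (Function.update v x True)).mono ?_) ((ih (Function.update v x False)).mono ?_)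
    all_goals
      rintro L ⟨y, hy, hL⟩
      by_cases hyx : y = x
      · subst hyx
        left
        simpa using hL
      · right
        refine ⟨y, ?_, by simpa [Function.update_of_ne hyx] using hL⟩
        simp only [Finset.coe_compl, Set.mem_compl_iff, Finset.mem_coe] at hy ⊢
        simp [hyx, hy]

/-- Completeness for finite sets of hypotheses. -/
theorem FregeProvable.of_consequence {V : Type} [Fintype V] (Hs : List (PropForm V))
    {A : PropForm V} (h : ∀ v, (∀ H ∈ Hs, H.eval v) → A.eval v) :
    FregeProvable {H | H ∈ Hs} A := by
  induction Hs generalizing A with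
  | nil => exact (FregeProvable.of_tautology fun v => h v (by simp)).mono (Set.empty_subset _)
  | cons B Hs ih =>
    have : FregeProvable {H | H ∈ Hs} (.imp B A) :=
      ih fun v hv hB => h v (by simpa using ⟨hB, hv⟩)
    exact (this.mono fun C hC => List.mem_cons_of_mem _ hC).mp (.hyp List.mem_cons_self)

/-! ### Frege derivations of polynomial size -/

/-- `PolyDer w k Γ Δ`: all formulas in `Δ` occur in some Frege derivation from `Γ` of total size
at most `w ^ k`, provided that the weight `w` is at least two. -/
def PolyDer {V : Type} (w k : ℕ) (Γ Δ : Set (PropForm V)) : Prop :=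
  2 ≤ w → ∃ P, IsFregeDerivation Γ P ∧ (∀ A ∈ Δ, A ∈ P) ∧ totalSize P ≤ w ^ k

/-- This turns a constant factor into a constant summand of the exponent; the next lemma does the
same for a sum of two costs. -/
theorem Nat.le_pow_self_of_two_le {w : ℕ} (hw : 2 ≤ w) (c : ℕ) : c ≤ w ^ c :=
  (Nat.lt_pow_self hw).le

theorem Nat.pow_add_pow_le_pow {w : ℕ} (hw : 2 ≤ w) (a b : ℕ) : w ^ a + w ^ b ≤ w ^ (a + b + 1) := by
  have h₁ : w ^ a ≤ w ^ (a + b) := Nat.pow_le_pow_right (by omega) (by omega)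
  have h₂ : w ^ b ≤ w ^ (a + b) := Nat.pow_le_pow_right (by omega) (by omega)
  have h₃ : w ^ (a + b + 1) = w ^ (a + b) * w := pow_succ _ _
  have h₄ : w ^ (a + b) * 2 ≤ w ^ (a + b) * w := Nat.mul_le_mul_left _ hw
  omega

namespace PolyDer

variable {V : Type} {w a b k l : ℕ} {Γ Γ' Δ Δ' Θ : Set (PropForm V)} {A B : PropForm V}

theorem le (h : PolyDer w k Γ Δ) (hkl : k ≤ l) : PolyDer w l Γ Δ := fun hw => by
  obtain ⟨P, h₁, h₂, h₃⟩ := h hw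
  exact ⟨P, h₁, h₂, h₃.trans (Nat.pow_le_pow_right (by omega) hkl)⟩

theorem mono (hΓ : Γ ⊆ Γ') (hΔ : Δ' ⊆ Δ) (h : PolyDer w k Γ Δ) : PolyDer w k Γ' Δ' := fun hw => by
  obtain ⟨P, h₁, h₂, h₃⟩ := h hw
  exact ⟨P, h₁.mono hΓ, fun A hA => h₂ A (hΔ hA), h₃⟩

theorem monoLeft (hΓ : Γ ⊆ Γ') (h : PolyDer w k Γ Δ) : PolyDer w k Γ' Δ := h.mono hΓ le_rfl

/-- `Δ` stays among the derived formulas, so successive layers of auxiliary facts can be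
accumulated. Each use raises the exponent, so only boundedly many cuts may be nested. -/
theorem cut (h₁ : PolyDer w k Γ Δ) (h₂ : PolyDer w l (Γ ∪ Δ) Θ) :
    PolyDer w (k + l + 1) Γ (Δ ∪ Θ) := fun hw => by
  obtain ⟨P, hP, hΔ, hsP⟩ := h₁ hw
  obtain ⟨Q, hQ, hΘ, hsQ⟩ := h₂ hw
  obtain ⟨Q', hQ', hmem, hs⟩ := hP.append (fun A hA => hA.imp_right (hΔ A)) hQ
  refine ⟨Q' ++ P, hQ', ?_, ?_⟩
  · rintro A (hA | hA)
    · exact List.mem_append_right _ (hΔ A hA)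
    · exact hmem A (hΘ A hA)
  · rw [totalSize_append]
    have := Nat.pow_add_pow_le_pow hw k l
    omega

theorem trans (h₁ : PolyDer w k Γ Δ) (h₂ : PolyDer w l (Γ ∪ Δ) Θ) : PolyDer w (k + l + 1) Γ Θ :=
  (h₁.cut h₂).mono le_rfl Set.subset_union_right

theorem union (h₁ : PolyDer w k Γ Δ) (h₂ : PolyDer w l Γ Θ) :
    PolyDer w (k + l + 1) Γ (Δ ∪ Θ) :=
  h₁.cut (h₂.monoLeft Set.subset_union_left)

theorem hyp (hA : A ∈ Γ) (hs : A.size ≤ w ^ k) : PolyDer w k Γ {A} := fun _ =>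
  ⟨[A], ⟨Or.inr (Or.inl hA), trivial⟩, by simp, by simpa [totalSize] using hs⟩

/-- The cost of deriving finitely many sets of formulas is at most the sum of the costs. -/
theorem exists_of_list {ι : Type*} {N : ℕ} (s : List ι) (f : ι → Set (PropForm V))
    (h : ∀ i ∈ s, ∃ P, IsFregeDerivation Γ P ∧ (∀ A ∈ f i, A ∈ P) ∧ totalSize P ≤ N) :
    ∃ P, IsFregeDerivation Γ P ∧ (∀ i ∈ s, ∀ A ∈ f i, A ∈ P) ∧ totalSize P ≤ s.length * N := by
  induction s with
  | nil => exact ⟨[], trivial, by simp, by simp [totalSize]⟩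
  | cons i s ih =>
    obtain ⟨P, hP, hmem, hsP⟩ := ih fun j hj => h j (List.mem_cons_of_mem _ hj)
    obtain ⟨Q, hQ, hmemQ, hsQ⟩ := h i List.mem_cons_self
    obtain ⟨Q', hQ', hmem', hs⟩ := hP.append (fun A hA => Or.inl hA) hQ
    refine ⟨Q' ++ P, hQ', ?_, ?_⟩
    · intro j hj A hA
      rcases List.mem_cons.1 hj with rfl | hj
      · exact hmem' A (hmemQ A hA)
      · exact List.mem_append_right _ (hmem j hj A hA)
    · rw [totalSize_append, List.length_cons, add_mul]
      omega

theorem of_list {ι : Type*} (s : List ι) (hs : s.length ≤ w ^ a) (f : ι → Set (PropForm V))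
    (h : ∀ i ∈ s, PolyDer w k Γ (f i)) : PolyDer w (a + k) Γ {A | ∃ i ∈ s, A ∈ f i} := fun hw => by
  obtain ⟨P, hP, hmem, hsP⟩ := exists_of_list s f fun i hi => h i hi hw
  refine ⟨P, hP, fun A ⟨i, hi, hA⟩ => hmem i hi A hA, hsP.trans ?_⟩
  rw [pow_add]
  exact Nat.mul_le_mul_right _ hs

theorem gather {ι : Type} [Fintype ι] (hc : Fintype.card ι ≤ w ^ a) (p : ι → Prop)
    (f : ι → Set (PropForm V)) (h : ∀ i, p i → PolyDer w k Γ (f i)) :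
    PolyDer w (a + k) Γ {A | ∃ i, p i ∧ A ∈ f i} := by
  classical
  refine (of_list (a := a) ((Finset.univ : Finset ι).filter p).toList ?_ f
    fun i hi => h i (by simpa using hi)).mono le_rfl ?_
  · rw [Finset.length_toList]
    exact (Finset.card_filter_le _ _).trans hc
  · rintro A ⟨i, hi, hA⟩
    exact ⟨i, by simpa using hi, hA⟩

/-- Every propositional inference has derivations whose size is linear in the size of the
formulas substituted into it. -/
theorem schema {n : ℕ} (Hs : List (PropForm (Fin n))) (T : PropForm (Fin n))
    (h : ∀ v, (∀ H ∈ Hs, H.eval v) → T.eval v) :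
    ∃ k, ∀ {V : Type} {Γ : Set (PropForm V)} {w b : ℕ} (s : Fin n → PropForm V),
      (∀ H ∈ Hs, H.subst s ∈ Γ) → (∀ x, (s x).size ≤ w ^ b) →
        PolyDer w (k + b) Γ {T.subst s} := by
  obtain ⟨P, hP, hT⟩ := FregeProvable.of_consequence Hs h
  refine ⟨totalSize P, fun {V Γ w b} s hs hsize hw => ⟨P.map (PropForm.subst s), ?_, ?_, ?_⟩⟩
  · refine (hP.subst s).mono ?_
    rintro _ ⟨H, hH, rfl⟩
    exact hs H hH
  · rintro _ rfl
    exact List.mem_map_of_mem hT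
  · refine (totalSize_map_subst_le s (Nat.one_le_pow _ _ (by omega)) hsize P).trans ?_
    rw [pow_add]
    exact Nat.mul_le_mul_right _ (Nat.le_pow_self_of_two_le hw _)

end PolyDer

/-! ### Sizes and rules for long disjunctions -/

theorem PropForm.length_le_size_bigDisj {V : Type} (L : List (PropForm V)) :
    L.length ≤ (PropForm.bigDisj L).size := by
  induction L with
  | nil => simp
  | cons A L ih =>
    simp only [List.length_cons, PropForm.bigDisj, PropForm.size]
    have := A.one_le_size
    omega

theorem PropForm.size_bigDisj {V : Type} (L : List (PropForm V)) :
    (PropForm.bigDisj L).size = totalSize L + L.length + 1 := by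
  induction L with
  | nil => simp [PropForm.bigDisj, PropForm.size, totalSize]
  | cons A L ih =>
    simp only [totalSize, List.map_cons, List.sum_cons, List.length_cons, PropForm.bigDisj,
      PropForm.size] at ih ⊢
    omega

theorem PropForm.size_le_size_bigDisj {V : Type} {L : List (PropForm V)} {A : PropForm V}
    (h : A ∈ L) : A.size ≤ (PropForm.bigDisj L).size := by
  induction L with
  | nil => simp at h
  | cons B L ih =>
    simp only [PropForm.bigDisj, PropForm.size]
    rcases List.mem_cons.1 h with rfl | h
    · omega
    · have := ih h
      omega

namespace PolyDer

open PropForm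

/-- Elimination of a long disjunction. -/
theorem bigDisj_elim : ∃ k, ∀ {V : Type} {Γ : Set (PropForm V)} {w b : ℕ} (L : List (PropForm V))
    (B : PropForm V), bigDisj L ∈ Γ → (∀ A ∈ L, imp A B ∈ Γ) → (bigDisj L).size ≤ w ^ b →
      B.size ≤ w ^ b → PolyDer w (k + 3 * b) Γ {B} := by
  obtain ⟨k₁, h₁⟩ := schema (n := 1) [] (.imp .bot (.var 0)) (by simp [eval])
  obtain ⟨k₂, h₂⟩ := schema (n := 3) [.imp (.var 0) (.var 2), .imp (.var 1) (.var 2)]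
    (.imp (.disj (.var 0) (.var 1)) (.var 2)) (by simp [eval]; tauto)
  obtain ⟨k₃, h₃⟩ := schema (n := 2) [.var 0, .imp (.var 0) (.var 1)] (.var 1) (by simp [eval]; tauto)
  -- The size is bounded by a multiple of a fixed power, with the factor growing linearly in the
  -- length of `L`. Applying `cut` once per disjunct would instead let the exponent grow with the
  -- length.
  have key : ∀ {V : Type} {Γ : Set (PropForm V)} {w b : ℕ} (L : List (PropForm V))
      (B : PropForm V), 2 ≤ w → (∀ A ∈ L, imp A B ∈ Γ) → (bigDisj L).size ≤ w ^ b →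
      B.size ≤ w ^ b → ∃ P, IsFregeDerivation Γ P ∧ imp (bigDisj L) B ∈ P ∧
        totalSize P ≤ (L.length + 1) * w ^ (k₁ + k₂ + b) := by
    intro V Γ w b L B hw hL hs hB
    induction L with
    | nil =>
      obtain ⟨P, hP, hm, hsP⟩ := h₁ (Γ := Γ) (w := w) (b := b) ![B] (by simp) (by simpa using hB) hw
      refine ⟨P, hP, hm _ rfl, ?_⟩
      simpa using hsP.trans (Nat.pow_le_pow_right (by omega) (by omega))
    | cons A L ih =>
      simp only [bigDisj, size] at hs
      obtain ⟨P, hP, hm, hsP⟩ := ih (fun C hC => hL C (List.mem_cons_of_mem _ hC)) (by omega)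
      obtain ⟨Q, hQ, hmQ, hsQ⟩ := h₂ (Γ := Γ ∪ {imp (bigDisj L) B}) (w := w) (b := b)
        ![A, bigDisj L, B] (by
          simp only [List.forall_mem_cons]
          exact ⟨Or.inl (hL A List.mem_cons_self), Or.inr rfl, by simp⟩)
        (by simp only [Fin.forall_fin_succ]; exact ⟨by simp; omega, by simp; omega, by simpa using hB, by simp⟩) hw
      obtain ⟨Q', hQ', hmem', hs'⟩ := hP.append
        (fun C hC => hC.imp_right fun h => by rwa [Set.mem_singleton_iff.1 h]) hQ
      refine ⟨Q' ++ P, hQ', hmem' _ (hmQ _ rfl), ?_⟩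
      rw [totalSize_append, List.length_cons]
      have : w ^ (k₂ + b) ≤ w ^ (k₁ + k₂ + b) := Nat.pow_le_pow_right (by omega) (by omega)
      linarith
  refine ⟨k₁ + k₂ + k₃ + 2, fun {V Γ w b} L B hL hLB hs hB => ?_⟩
  have : PolyDer w (k₁ + k₂ + 2 * b + 1) Γ {imp (bigDisj L) B} := fun hw => by
    obtain ⟨P, hP, hm, hsP⟩ := key L B hw hLB hs hB
    refine ⟨P, hP, by simpa using hm, hsP.trans ?_⟩
    have h₁ := length_le_size_bigDisj L
    calc (L.length + 1) * w ^ (k₁ + k₂ + b) ≤ (w ^ b * w) * w ^ (k₁ + k₂ + b) := by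
          have : 1 ≤ w ^ b := Nat.one_le_pow _ _ (by omega)
          exact Nat.mul_le_mul_right _ (by nlinarith)
      _ = w ^ (k₁ + k₂ + 2 * b + 1) := by ring
  refine (this.trans (h₃ (w := w) (b := b) ![bigDisj L, B] ?_ ?_)).le ?_
  rotate_left
  · simpa [Fin.forall_fin_succ] using ⟨hs, hB⟩
  · omega
  · simp only [List.forall_mem_cons]
    exact ⟨Or.inl hL, Or.inr rfl, by simp⟩

/-- Elimination of a long disjunction whose cases have been derived separately. -/
theorem bigDisj_cases : ∃ k, ∀ {V : Type} {Γ : Set (PropForm V)} {w b l : ℕ}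
    (L : List (PropForm V)) (B : PropForm V), bigDisj L ∈ Γ →
      (∀ A ∈ L, PolyDer w l Γ {imp A B}) → (bigDisj L).size ≤ w ^ b →
      B.size ≤ w ^ b → PolyDer w (k + l + 4 * b) Γ {B} := by
  obtain ⟨k, hk⟩ := bigDisj_elim
  refine ⟨k + 1, fun {V Γ w b l} L B hL hLB hs hB => ?_⟩
  have h₁ := of_list L ((length_le_size_bigDisj L).trans hs) _ hLB
  exact (h₁.trans (hk L B (Or.inl hL) (fun A hA => Or.inr ⟨A, hA, rfl⟩) hs hB)).le (by omega)

/-- Introduction of a long disjunction on the right of an implication. -/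
theorem imp_bigDisj : ∃ k, ∀ {V : Type} {Γ : Set (PropForm V)} {w b : ℕ} (L : List (PropForm V))
    (C A : PropForm V), A ∈ L → imp C A ∈ Γ → (bigDisj L).size ≤ w ^ b → C.size ≤ w ^ b →
      PolyDer w (k + 2 * b) Γ {imp C (bigDisj L)} := by
  obtain ⟨k₁, h₁⟩ := schema (n := 3) [.imp (.var 2) (.var 0)]
    (.imp (.var 2) (.disj (.var 0) (.var 1))) (by simp [eval]; tauto)
  obtain ⟨k₂, h₂⟩ := schema (n := 3) [.imp (.var 2) (.var 1)]
    (.imp (.var 2) (.disj (.var 0) (.var 1))) (by simp [eval]; tauto)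
  have key : ∀ {V : Type} {Γ : Set (PropForm V)} {w b : ℕ} (L : List (PropForm V))
      (C A : PropForm V), 2 ≤ w → A ∈ L → imp C A ∈ Γ → (bigDisj L).size ≤ w ^ b →
      C.size ≤ w ^ b → ∃ P, IsFregeDerivation Γ P ∧ imp C (bigDisj L) ∈ P ∧
        totalSize P ≤ L.length * w ^ (k₁ + k₂ + b) := by
    intro V Γ w b L C A hw hAL hA hs hC
    induction L with
    | nil => simp at hAL
    | cons B L ih =>
      simp only [bigDisj, size] at hs
      have hsz : ∀ x, (![B, bigDisj L, C] x).size ≤ w ^ b := by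
        simp only [Fin.forall_fin_succ]
        exact ⟨by simp; omega, by simp; omega, by simpa using hC, by simp⟩
      rcases List.mem_cons.1 hAL with rfl | hAL
      · obtain ⟨P, hP, hm, hsP⟩ := h₁ (Γ := Γ) (w := w) (b := b) ![A, bigDisj L, C]
          (by simpa [subst] using hA) hsz hw
        refine ⟨P, hP, hm _ rfl, hsP.trans ?_⟩
        calc w ^ (k₁ + b) ≤ w ^ (k₁ + k₂ + b) := Nat.pow_le_pow_right (by omega) (by omega)
          _ ≤ _ := Nat.le_mul_of_pos_left _ (by simp)
      · obtain ⟨P, hP, hm, hsP⟩ := ih hAL (by omega)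
        obtain ⟨Q, hQ, hmQ, hsQ⟩ := h₂ (Γ := Γ ∪ {imp C (bigDisj L)}) (w := w) (b := b)
          ![B, bigDisj L, C] (by simp [subst]) hsz hw
        obtain ⟨Q', hQ', hmem', hs'⟩ := hP.append
          (fun C hC => hC.imp_right fun h => by rwa [Set.mem_singleton_iff.1 h]) hQ
        refine ⟨Q' ++ P, hQ', hmem' _ (hmQ _ rfl), ?_⟩
        rw [totalSize_append, List.length_cons]
        have : w ^ (k₂ + b) ≤ w ^ (k₁ + k₂ + b) := Nat.pow_le_pow_right (by omega) (by omega)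
        linarith
  refine ⟨k₁ + k₂, fun {V Γ w b} L C A hAL hA hs hC hw => ?_⟩
  obtain ⟨P, hP, hm, hsP⟩ := key L C A hw hAL hA hs hC
  refine ⟨P, hP, by simpa using hm, hsP.trans ?_⟩
  calc L.length * w ^ (k₁ + k₂ + b) ≤ w ^ b * w ^ (k₁ + k₂ + b) :=
        Nat.mul_le_mul_right _ ((length_le_size_bigDisj L).trans hs)
    _ = w ^ (k₁ + k₂ + 2 * b) := by ring

/-- Introduction of a long disjunction. -/
theorem bigDisj_intro : ∃ k, ∀ {V : Type} {Γ : Set (PropForm V)} {w b : ℕ} (L : List (PropForm V))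
    (A : PropForm V), A ∈ L → A ∈ Γ → (bigDisj L).size ≤ w ^ b →
      PolyDer w (k + 4 * b) Γ {bigDisj L} := by
  obtain ⟨k₁, h₁⟩ := schema (n := 1) [] (.imp (.var 0) (.var 0)) (by simp [eval])
  obtain ⟨k₂, h₂⟩ := imp_bigDisj
  obtain ⟨k₃, h₃⟩ := schema (n := 2) [.var 0, .imp (.var 0) (.var 1)] (.var 1)
    (by simp [eval]; tauto)
  refine ⟨k₁ + k₂ + k₃ + 2, fun {V Γ w b} L A hAL hA hs => ?_⟩
  have hA' := (size_le_size_bigDisj hAL).trans hs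
  have e₁ := h₁ (Γ := Γ) (w := w) (b := b) ![A] (by simp) (by simpa using hA')
  have e₂ := e₁.trans (h₂ L A A hAL (Or.inr rfl) hs hA')
  have e₃ := h₃ (Γ := Γ ∪ {imp A (bigDisj L)}) (w := w) (b := b) ![A, bigDisj L]
    (List.forall_iff_forall_mem.1 ⟨Or.inl hA, Or.inr rfl⟩)
    (by simpa [Fin.forall_fin_succ] using ⟨hA', hs⟩)
  exact (e₂.trans e₃).le (by omega)

/-- A chain of derivations. -/
theorem chain (f : ℕ → PropForm V) {N : ℕ} (hN : N ≤ w ^ a) (h₀ : PolyDer w k Γ {f 0})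
    (h : ∀ j < N, PolyDer w k (Γ ∪ {f j}) {f (j + 1)}) : PolyDer w (k + a + 1) Γ {f N} := fun hw => by
  -- Again the cost is counted linearly in the number of links, so that the exponent does not depend
  -- on `N`.
  have key : ∀ j ≤ N, ∃ P, IsFregeDerivation Γ P ∧ f j ∈ P ∧ totalSize P ≤ (j + 1) * w ^ k := by
    intro j hj
    induction j with
    | zero =>
      obtain ⟨P, hP, hm, hs⟩ := h₀ hw
      exact ⟨P, hP, hm _ rfl, by simpa using hs⟩
    | succ j ih =>
      obtain ⟨P, hP, hm, hsP⟩ := ih (by omega)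
      obtain ⟨Q, hQ, hmQ, hsQ⟩ := h j (by omega) hw
      obtain ⟨Q', hQ', hmem', hs'⟩ := hP.append
        (fun C hC => hC.imp_right fun h => by rwa [Set.mem_singleton_iff.1 h]) hQ
      refine ⟨Q' ++ P, hQ', hmem' _ (hmQ _ rfl), ?_⟩
      rw [totalSize_append]
      linarith
  obtain ⟨P, hP, hm, hsP⟩ := key N le_rfl
  refine ⟨P, hP, by simpa using hm, hsP.trans ?_⟩
  have : 1 ≤ w ^ a := Nat.one_le_pow _ _ (by omega)
  calc (N + 1) * w ^ k ≤ (w ^ a * w) * w ^ k := Nat.mul_le_mul_right _ (by nlinarith)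
    _ = w ^ (k + a + 1) := by ring

end PolyDer

/-! ### Rankings and profiles -/

/-- The ranking `π` with the object `a` moved to the top. -/
def moveToTop {m : ℕ} (a : Fin m) (π : Equiv.Perm (Fin m)) : Equiv.Perm (Fin m) :=
  (π.symm.trans (Fin.cycleRange (π.symm a))).symm

theorem moveToTop_symm_apply {m : ℕ} (a : Fin m) (π : Equiv.Perm (Fin m)) (o : Fin m) :
    (moveToTop a π).symm o = Fin.cycleRange (π.symm a) (π.symm o) := rfl

theorem moveToTop_le {m : ℕ} (a : Fin m) (π : Equiv.Perm (Fin m)) (o : Fin m) :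
    (moveToTop a π).symm a ≤ (moveToTop a π).symm o := by
  have : NeZero m := ⟨fun h => (h ▸ a).elim0⟩
  rw [moveToTop_symm_apply, Fin.cycleRange_self]
  exact Fin.zero_le _

/-- Moving `a` to the top leaves the order of the other objects unchanged: those above `a` drop by
one position, those below stay. -/
theorem moveToTop_le_of_le {m : ℕ} {a b o : Fin m} {π : Equiv.Perm (Fin m)} (hb : b ≠ a)
    (ho : o ≠ a) (h : π.symm b ≤ π.symm o) : (moveToTop a π).symm b ≤ (moveToTop a π).symm o := by
  have : NeZero m := ⟨fun h => (h ▸ a).elim0⟩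
  have hb' : (π.symm b).val ≠ (π.symm a).val := fun h => hb (π.symm.injective (Fin.ext h))
  have ho' : (π.symm o).val ≠ (π.symm a).val := fun h => ho (π.symm.injective (Fin.ext h))
  rw [Fin.le_def] at h ⊢
  rw [moveToTop_symm_apply, moveToTop_symm_apply]
  have key : ∀ j : Fin m, j.val ≠ (π.symm a).val → (Fin.cycleRange (π.symm a) j).val =
      if j.val < (π.symm a).val then j.val + 1 else j.val := by
    intro j hj
    split_ifs with hlt
    · exact Fin.coe_cycleRange_of_lt hlt
    · rw [Fin.cycleRange_of_gt (Fin.lt_def.2 (by omega))]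
  rw [key _ hb', key _ ho']
  split_ifs <;> omega

/-- The ranking that starts with `a`, `b`. -/
def topTwo {m : ℕ} (a b : Fin m) : Equiv.Perm (Fin m) := moveToTop a (moveToTop b 1)

/-- The ranking that starts with `a`, `b`, `c`. -/
def topThree {m : ℕ} (a b c : Fin m) : Equiv.Perm (Fin m) :=
  moveToTop a (moveToTop b (moveToTop c 1))

section

variable {m : ℕ} {a b c o : Fin m}

theorem topTwo_fst_le (a b o : Fin m) : (topTwo a b).symm a ≤ (topTwo a b).symm o :=
  moveToTop_le _ _ _

theorem topTwo_snd_le (hab : a ≠ b) (ho : o ≠ a) : (topTwo a b).symm b ≤ (topTwo a b).symm o :=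
  moveToTop_le_of_le hab.symm ho (moveToTop_le _ _ _)

theorem topThree_fst_lt (b c : Fin m) (ho : o ≠ a) :
    (topThree a b c).symm a < (topThree a b c).symm o :=
  lt_of_le_of_ne (moveToTop_le _ _ _) fun h => ho ((Equiv.injective _ h).symm)

theorem topThree_snd_lt (c : Fin m) (hab : a ≠ b) (ha : o ≠ a) (hb : o ≠ b) :
    (topThree a b c).symm b < (topThree a b c).symm o :=
  lt_of_le_of_ne (moveToTop_le_of_le hab.symm ha (moveToTop_le _ _ _))
    fun h => hb ((Equiv.injective _ h).symm)

theorem topThree_trd_lt (hac : a ≠ c) (hbc : b ≠ c) (ha : o ≠ a) (hb : o ≠ b) (hc : o ≠ c) :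
    (topThree a b c).symm c < (topThree a b c).symm o :=
  lt_of_le_of_ne
    (moveToTop_le_of_le hac.symm ha (moveToTop_le_of_le hbc.symm hb (moveToTop_le _ _ _)))
    fun h => hc ((Equiv.injective _ h).symm)

end

/-- From `π` to `π'` no object ranked below `o` overtakes it. -/
def LiftsAt {m : ℕ} (o : Fin m) (π π' : Equiv.Perm (Fin m)) : Prop :=
  ∀ o', π.symm o ≤ π.symm o' → π'.symm o ≤ π'.symm o'

/-- From `R` to `R'` no object overtakes `o` in the ranking of any agent. -/
def Lifts {n m : ℕ} (o : Fin m) (R R' : GSProfile n m) : Prop := ∀ i, LiftsAt o (R i) (R' i)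

theorem LiftsAt.refl {m : ℕ} (o : Fin m) (π : Equiv.Perm (Fin m)) : LiftsAt o π π := fun _ h => h

theorem LiftsAt.of_top {m : ℕ} (a b : Fin m) (π : Equiv.Perm (Fin m)) :
    LiftsAt a π (topTwo a b) := fun o _ => topTwo_fst_le a b o

/-- In `topTwo a b` only `a` stands above `b`, and it did so already in `π`. -/
theorem LiftsAt.of_lt {m : ℕ} {a b : Fin m} {π : Equiv.Perm (Fin m)} (h : π.symm a < π.symm b) :
    LiftsAt b π (topTwo a b) := fun o ho =>
  topTwo_snd_le (fun hab => h.ne (by rw [hab])) fun hoa => (ho.trans_eq (by rw [hoa])).not_gt h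

/-- The profile in which the agents in `A` rank `a`, `b` on top and the others `b`, `a`. -/
def opposed {n m : ℕ} (A : Finset (Fin n)) (a b : Fin m) : GSProfile n m := fun i =>
  if i ∈ A then topTwo a b else topTwo b a

theorem opposed_compl {n m : ℕ} (A : Finset (Fin n)) (a b : Fin m) :
    opposed Aᶜ a b = opposed A b a := by
  funext i
  by_cases h : i ∈ A <;> simp [opposed, h]

/-- If `b` wins at `R`, it would also win at the opposed profile, so `A` would fail to be decisive
for `(a, b)`. The agents outside `A` are unconstrained because they end up with `b` on top. -/
theorem lifts_opposed {n m : ℕ} {A : Finset (Fin n)} {a b : Fin m} {R : GSProfile n m}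
    (h : ∀ i ∈ A, (R i).symm a < (R i).symm b) : Lifts b R (opposed A a b) := fun i => by
  by_cases hi : i ∈ A
  · simpa [opposed, hi] using LiftsAt.of_lt (h i hi)
  · simpa [opposed, hi] using LiftsAt.of_top b a (R i)

theorem lifts_opposed' {n m : ℕ} {A : Finset (Fin n)} {a b : Fin m} {R : GSProfile n m}
    (h : ∀ i ∉ A, (R i).symm b < (R i).symm a) : Lifts a R (opposed A a b) := by
  rw [← opposed_compl]
  simpa using lifts_opposed (A := Aᶜ) (by simpa using h)

/-- A profile in which the majorities for `a` over `b` (by `A`), for `b` over `c` (by `B`) meet. -/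
def condorcet {n m : ℕ} (A B : Finset (Fin n)) (a b c : Fin m) : GSProfile n m := fun i =>
  if i ∈ A then if i ∈ B then topThree a b c else topThree c a b
  else if i ∈ B then topThree b c a else topThree c b a

section

variable {n m : ℕ} (A B : Finset (Fin n)) {a b c : Fin m}

/-- In `condorcet A B a b c` exactly `A` prefers `a` to `b`, exactly `B` prefers `b` to `c`, and
exactly `A ∩ B` prefers `a` to `c`. This and the next two lemmas carry a win of `b`, `c` or `a` to
the opposed profile of the relevant pair. -/
theorem lifts_condorcet_snd (hab : a ≠ b) (hac : a ≠ c) (hbc : b ≠ c) :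
    Lifts b (condorcet A B a b c) (opposed A a b) := by
  refine lifts_opposed fun i hi => ?_
  by_cases h : i ∈ B
  · simpa [condorcet, hi, h] using topThree_fst_lt b c hab.symm
  · simpa [condorcet, hi, h] using topThree_snd_lt b hac.symm hbc hab.symm

theorem lifts_condorcet_trd (hab : a ≠ b) (hac : a ≠ c) (hbc : b ≠ c) :
    Lifts c (condorcet A B a b c) (opposed B b c) := by
  refine lifts_opposed fun i hi => ?_
  by_cases h : i ∈ A
  · simpa [condorcet, hi, h] using topThree_snd_lt c hab hac.symm hbc.symm
  · simpa [condorcet, hi, h] using topThree_fst_lt c a hbc.symm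

theorem lifts_condorcet_fst (hab : a ≠ b) (hac : a ≠ c) (hbc : b ≠ c) :
    Lifts a (condorcet A B a b c) (opposed (A ∩ B) a c) := by
  refine lifts_opposed' fun i hi => ?_
  by_cases h : i ∈ A <;> by_cases h' : i ∈ B
  · simp [h, h'] at hi
  · simpa [condorcet, h, h'] using topThree_fst_lt a b hac
  · simpa [condorcet, h, h'] using topThree_snd_lt a hbc hab hac
  · simpa [condorcet, h, h'] using topThree_fst_lt b a hac

theorem condorcet_lt {o : Fin m} (hab : a ≠ b) (hac : a ≠ c) (ha : o ≠ a) (hb : o ≠ b) (hc : o ≠ c) (i : Fin n) :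
    (condorcet A B a b c i).symm a < (condorcet A B a b c i).symm o := by
  by_cases h : i ∈ A <;> by_cases h' : i ∈ B
  · simpa [condorcet, h, h'] using topThree_fst_lt b c ha
  · simpa [condorcet, h, h'] using topThree_snd_lt b hac.symm hc ha
  · simpa [condorcet, h, h'] using topThree_trd_lt hab.symm hac.symm hb hc ha
  · simpa [condorcet, h, h'] using topThree_trd_lt hac.symm hab.symm hc hb ha

end

/-! ### The weight `(m!)^n`: the number of profiles -/

/-- The number of profiles. -/
def gsWeight (n m : ℕ) : ℕ := m.factorial ^ n

theorem card_gsProfile (n m : ℕ) : Fintype.card (GSProfile n m) = gsWeight n m := by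
  simp [GSProfile, gsWeight, Fintype.card_perm]

theorem two_pow_le_gsWeight {n m : ℕ} (hm : 3 ≤ m) : 2 ^ n ≤ gsWeight n m :=
  Nat.pow_le_pow_left ((by omega : 2 ≤ m).trans m.self_le_factorial) n

theorem two_le_gsWeight {n m : ℕ} (hn : 1 ≤ n) (hm : 3 ≤ m) : 2 ≤ gsWeight n m :=
  (by simpa using Nat.pow_le_pow_right (n := 2) (by omega) hn : 2 ≤ 2 ^ n).trans
    (two_pow_le_gsWeight hm)

theorem agents_le_gsWeight {n m : ℕ} (hm : 3 ≤ m) : n ≤ gsWeight n m :=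
  (Nat.lt_two_pow_self).le.trans (two_pow_le_gsWeight hm)

theorem factorial_le_gsWeight {n m : ℕ} (hn : 1 ≤ n) : m.factorial ≤ gsWeight n m :=
  Nat.le_self_pow (by omega) _

theorem objects_le_gsWeight {n m : ℕ} (hn : 1 ≤ n) : m ≤ gsWeight n m :=
  m.self_le_factorial.trans (factorial_le_gsWeight hn)

theorem gsWeight_mono {n m n' m' : ℕ} (hn : n' ≤ n) (hm : m' ≤ m) :
    gsWeight n' m' ≤ gsWeight n m :=
  (Nat.pow_le_pow_left (Nat.factorial_le hm) n').trans
    (Nat.pow_le_pow_right (Nat.factorial_pos m) hn)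

open PropForm

/-! ### The clauses of `GS_{n,m}` -/

/-- The set of clauses of `GS_{n,m}`. -/
def gsClauses (n m : ℕ) : Set (PropForm (GSVar n m)) := {A | A ∈ gsFormula n m}

section

variable {n m : ℕ}

theorem total_mem_gsClauses (R : GSProfile n m) :
    bigDisj ((List.finRange m).map fun o => .var (R, o)) ∈ gsClauses n m := by
  simp only [gsClauses, gsFormula, Set.mem_ofPred_eq, List.mem_append]
  exact Or.inl (Or.inl (Or.inl (Or.inl (List.mem_map.2 ⟨R, by simp [gsProfiles], rfl⟩))))

theorem unique_mem_gsClauses (R : GSProfile n m) {o₁ o₂ : Fin m} (h : o₁ ≠ o₂) :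
    bigDisj [.neg (.var (R, o₁)), .neg (.var (R, o₂))] ∈ gsClauses n m := by
  simp only [gsClauses, gsFormula, Set.mem_ofPred_eq, List.mem_append]
  refine Or.inl (Or.inl (Or.inl (Or.inr ?_)))
  simp only [gsUnique, List.mem_flatMap, List.mem_map, List.mem_filter]
  exact ⟨R, by simp [gsProfiles], o₁, by simp, o₂, by simpa using h, rfl⟩

open Classical in
theorem nondict_mem_gsClauses (i : Fin n) :
    bigDisj ((gsProfiles n m).flatMap fun R =>
      ((List.finRange m).filter fun o => IsTopObject (R i) o).map fun o => .neg (.var (R, o))) ∈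
        gsClauses n m := by
  simp only [gsClauses, gsFormula, Set.mem_ofPred_eq, List.mem_append]
  exact Or.inl (Or.inl (Or.inr (List.mem_map.2 ⟨i, by simp, rfl⟩)))

theorem onto_mem_gsClauses (o : Fin m) :
    bigDisj ((gsProfiles n m).map fun R => .var (R, o)) ∈ gsClauses n m := by
  simp only [gsClauses, gsFormula, Set.mem_ofPred_eq, List.mem_append]
  exact Or.inl (Or.inr (List.mem_map.2 ⟨o, by simp, rfl⟩))

theorem strategyproof_mem_gsClauses (R : GSProfile n m) (o : Fin m) (i : Fin n)
    (π : Equiv.Perm (Fin m)) :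
    bigDisj (.neg (.var (R, o)) ::
      ((List.finRange m).filter fun o' => (R i).symm o ≤ (R i).symm o').map fun o' =>
        .var (Function.update R i π, o')) ∈ gsClauses n m := by
  simp only [gsClauses, gsFormula, Set.mem_ofPred_eq, List.mem_append]
  refine Or.inr ?_
  simp only [gsStrategyproof, List.mem_flatMap, List.mem_map]
  exact ⟨R, by simp [gsProfiles], o, by simp, i, by simp, π, by simp [gsRankings], rfl⟩

/-! ### Number and size of the clauses in terms of the weight -/

theorem size_bigDisj_le {V : Type} {L : List (PropForm V)} (h : ∀ A ∈ L, A.size ≤ 2) :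
    (bigDisj L).size ≤ 3 * L.length + 1 := by
  rw [size_bigDisj]
  have : totalSize L ≤ L.length * 2 := by
    simpa [totalSize] using List.sum_le_card_nsmul (L.map size) 2 (by simpa using h)
  omega

theorem length_gsProfiles : (gsProfiles n m).length = gsWeight n m := by
  rw [gsProfiles, Finset.length_toList, Finset.card_univ, card_gsProfile]

theorem card_gsVar_le (hn : 1 ≤ n) : Fintype.card (GSVar n m) ≤ gsWeight n m ^ 2 := by
  rw [Fintype.card_prod, card_gsProfile, Fintype.card_fin, sq]
  exact Nat.mul_le_mul_left _ (objects_le_gsWeight hn)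

theorem card_gsVar_prod_le (hn : 1 ≤ n) :
    Fintype.card (GSVar n m × GSVar n m) ≤ gsWeight n m ^ 4 := by
  rw [Fintype.card_prod]
  calc _ ≤ gsWeight n m ^ 2 * gsWeight n m ^ 2 :=
        Nat.mul_le_mul (card_gsVar_le hn) (card_gsVar_le hn)
    _ = gsWeight n m ^ 4 := by ring

theorem three_mul_add_le_pow {w N : ℕ} (hw : 2 ≤ w) (hN : N ≤ w) : 3 * N + 4 ≤ w ^ 4 := by
  have h₁ : 2 * 2 ≤ w * w := Nat.mul_le_mul hw hw
  have h₂ : 4 * (w * w) ≤ (w * w) * (w * w) := Nat.mul_le_mul_right _ h₁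
  have h₃ : 2 * w ≤ w * w := Nat.mul_le_mul_right _ hw
  have h₄ : w ^ 4 = (w * w) * (w * w) := by ring
  omega

theorem size_bigDisj_le_pow {V : Type} {w : ℕ} (hw : 2 ≤ w) {L : List (PropForm V)}
    (h : ∀ A ∈ L, A.size ≤ 2) (hL : L.length ≤ w + 1) : (bigDisj L).size ≤ w ^ 4 :=
  (size_bigDisj_le h).trans (by have := three_mul_add_le_pow hw le_rfl; omega)

theorem List.length_flatMap_le {α β : Type*} {l : List α} {f : α → List β} {c : ℕ}
    (h : ∀ a ∈ l, (f a).length ≤ c) : (l.flatMap f).length ≤ l.length * c := by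
  induction l with
  | nil => simp
  | cons a l ih =>
    rw [List.flatMap_cons, List.length_append, List.length_cons, add_mul]
    have := h a List.mem_cons_self
    have := ih fun b hb => h b (List.mem_cons_of_mem _ hb)
    omega

theorem size_le_of_mem_gsFormula (hn : 1 ≤ n) (hm : 3 ≤ m) {A : PropForm (GSVar n m)}
    (hA : A ∈ gsFormula n m) : A.size ≤ gsWeight n m ^ 8 := by
  classical
  have hw := two_le_gsWeight hn hm
  have hmw := objects_le_gsWeight (m := m) hn
  have hww : gsWeight n m * 2 ≤ gsWeight n m * gsWeight n m := Nat.mul_le_mul_left _ hw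
  -- The longest clauses, those against dictators, have up to `w * m ≤ w * w` literals. Using the
  -- fourth-power bound with `w * w` in place of `w` gives the exponent 8.
  have key : ∀ L : List (PropForm (GSVar n m)), (∀ A ∈ L, A.size ≤ 2) →
      L.length ≤ gsWeight n m * gsWeight n m → (bigDisj L).size ≤ gsWeight n m ^ 8 := by
    intro L hL hlen
    have := three_mul_add_le_pow (w := gsWeight n m * gsWeight n m) (by omega) hlen
    calc (bigDisj L).size ≤ _ := size_bigDisj_le hL
      _ ≤ _ := (Nat.add_le_add_left (by norm_num) _).trans this
      _ = gsWeight n m ^ 8 := by ring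
  simp only [gsFormula, List.mem_append] at hA
  rcases hA with (((hA | hA) | hA) | hA) | hA
  · obtain ⟨R, -, rfl⟩ := List.mem_map.1 hA
    exact key _ (by simp [size]) (by simp; omega)
  · simp only [gsUnique, List.mem_flatMap, List.mem_map] at hA
    obtain ⟨R, -, o₁, -, o₂, -, rfl⟩ := hA
    exact key _ (by simp [size]) (by simp; omega)
  · obtain ⟨i, -, rfl⟩ := List.mem_map.1 hA
    refine key _ ?_ ?_
    · simp only [List.mem_flatMap, List.mem_map]
      rintro _ ⟨R, -, o, -, rfl⟩
      simp [size]
    · refine (List.length_flatMap_le (c := m) fun R _ => ?_).trans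
        (Nat.mul_le_mul length_gsProfiles.le hmw)
      rw [List.length_map]
      exact (List.length_filter_le _ _).trans List.length_finRange.le
  · obtain ⟨o, -, rfl⟩ := List.mem_map.1 hA
    exact key _ (by simp [size]) (by simp [length_gsProfiles]; omega)
  · simp only [gsStrategyproof, List.mem_flatMap, List.mem_map] at hA
    obtain ⟨R, -, o, -, i, -, π, -, rfl⟩ := hA
    refine key _ (by simp [size]) ?_
    rw [List.length_cons, List.length_map]
    have := (List.length_filter_le (fun o' => decide ((R i).symm o ≤ (R i).symm o'))
      (List.finRange m)).trans List.length_finRange.le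
    omega

theorem length_gsFormula_le (hn : 1 ≤ n) (hm : 3 ≤ m) :
    (gsFormula n m).length ≤ gsWeight n m ^ 7 := by
  classical
  have hw := two_le_gsWeight hn hm
  have hmw := objects_le_gsWeight (m := m) hn
  have hnw := agents_le_gsWeight (n := n) hm
  have hfw := factorial_le_gsWeight (m := m) hn
  have h₁ : (gsTotal n m).length = gsWeight n m := by
    rw [gsTotal, List.length_map, length_gsProfiles]
  have h₂ : (gsUnique n m).length ≤ gsWeight n m * (gsWeight n m * gsWeight n m) := by
    refine (List.length_flatMap_le (c := gsWeight n m * gsWeight n m) fun R _ => ?_).trans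
      (Nat.mul_le_mul_right _ length_gsProfiles.le)
    refine (List.length_flatMap_le (c := gsWeight n m) fun o _ => ?_).trans
      (Nat.mul_le_mul_right _ (by simpa using hmw))
    rw [List.length_map]
    exact (List.length_filter_le _ _).trans (by simpa using hmw)
  have h₃ : (gsNondict n m).length = n := by simp [gsNondict]
  have h₄ : (gsOnto n m).length = m := by simp [gsOnto]
  have h₅ : (gsStrategyproof n m).length ≤
      gsWeight n m * (gsWeight n m * (gsWeight n m * gsWeight n m)) := by
    refine (List.length_flatMap_le (c := gsWeight n m * (gsWeight n m * gsWeight n m))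
      fun R _ => ?_).trans (Nat.mul_le_mul_right _ length_gsProfiles.le)
    refine (List.length_flatMap_le (c := gsWeight n m * gsWeight n m) fun o _ => ?_).trans
      (Nat.mul_le_mul_right _ (by simpa using hmw))
    refine (List.length_flatMap_le (c := gsWeight n m) fun i _ => ?_).trans
      (Nat.mul_le_mul_right _ (by simpa using hnw))
    rw [List.length_map, gsRankings, Finset.length_toList, Finset.card_univ, Fintype.card_perm,
      Fintype.card_fin]
    exact hfw
  simp only [gsFormula, List.length_append, h₁, h₃, h₄]
  generalize gsWeight n m = w at *
  -- The strategyproofness clauses dominate with at most `w ^ 4`. The five families together stay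
  -- below `8 * w ^ 4`, and `8 ≤ w ^ 3`.
  have e₁ : w * (w * (w * w)) = w ^ 4 := by ring
  have e₂ : w * (w * w) = w ^ 3 := by ring
  have e₃ : w ^ 3 ≤ w ^ 4 := Nat.pow_le_pow_right (by omega) (by omega)
  have e₄ : w ≤ w ^ 4 := Nat.le_self_pow (by omega) w
  have e₅ : w ^ 7 = w ^ 4 * w ^ 3 := by ring
  have e₆ : 2 ^ 3 ≤ w ^ 3 := Nat.pow_le_pow_left hw 3
  have e₇ : w ^ 4 * 2 ^ 3 ≤ w ^ 4 * w ^ 3 := Nat.mul_le_mul_left _ e₆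
  rw [e₂] at h₂
  rw [e₁] at h₅
  rw [e₅]
  generalize w ^ 4 * w ^ 3 = y, w ^ 4 = x, w ^ 3 = z at *
  omega

/-- There is one totality clause for every profile. This is what converts powers of the weight into
polynomials in the size of the formula. -/
theorem gsWeight_le_totalSize (n m : ℕ) : gsWeight n m ≤ totalSize (gsFormula n m) := by
  have h : (gsTotal n m).length ≤ totalSize (gsTotal n m) := by
    simpa [totalSize] using
      List.card_nsmul_le_sum ((gsTotal n m).map size) 1 (by simpa using fun A _ => A.one_le_size)
  rw [gsTotal, List.length_map, length_gsProfiles] at h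
  refine h.trans ?_
  simp only [gsFormula, totalSize_append]
  rw [gsTotal]
  omega

end

/-- The formula "not both `A` and `B`". -/
abbrev PropForm.incompatible {V : Type} (x y : V) : PropForm V := .imp (.var x) (.imp (.var y) .bot)

theorem PropForm.size_incompatible {V : Type} {w : ℕ} (hw : 2 ≤ w) (x y : V) :
    (incompatible x y).size ≤ w ^ 4 := by
  have := Nat.pow_le_pow_left hw 4
  simp only [size]
  omega

namespace PolyDer

/-- Inferences between formulas into which only variables are substituted. -/
theorem schema_var {n : ℕ} (Hs : List (PropForm (Fin n))) (T : PropForm (Fin n))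
    (h : ∀ v, (∀ H ∈ Hs, H.eval v) → T.eval v) :
    ∃ k, ∀ {V : Type} {Γ : Set (PropForm V)} {w : ℕ} (s : Fin n → V),
      Hs.Forall (fun H => H.subst (fun x => var (s x)) ∈ Γ) →
        PolyDer w k Γ {T.subst fun x => var (s x)} := by
  obtain ⟨k, hk⟩ := schema Hs T h
  exact ⟨k, fun s hs => hk (b := 0) _ (List.forall_iff_forall_mem.1 hs) fun x => by simp [size]⟩

/-- A whole family of facts costs one fact times the size of an index type that covers the family;
here pairs of variables or single variables will serve. -/
theorem of_range {V ι : Type} [Fintype ι] {w a k : ℕ} {Γ Θ : Set (PropForm V)}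
    (g : ι → PropForm V) (hc : Fintype.card ι ≤ w ^ a)
    (hΘ : ∀ A ∈ Θ, ∃ i, g i = A) (h : ∀ A ∈ Θ, PolyDer w k Γ {A}) : PolyDer w (a + k) Γ Θ := by
  refine (gather hc (fun i => g i ∈ Θ) (fun i => {g i}) fun i hi => h _ hi).mono le_rfl ?_
  intro A hA
  obtain ⟨i, rfl⟩ := hΘ A hA
  exact ⟨i, hA, rfl⟩

end PolyDer

open PolyDer

/-! ### Incompatible outcomes -/

/-- The outcomes `o` at `R` and `o'` at `R'` are incompatible by uniqueness or strategyproofness. -/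
def GSConflict {n m : ℕ} (R : GSProfile n m) (o : Fin m) (R' : GSProfile n m) (o' : Fin m) : Prop :=
  (R = R' ∧ o ≠ o') ∨ ∃ i π, R' = Function.update R i π ∧ (R i).symm o' < (R i).symm o

/-- The formulas expressing that conflicting outcomes are incompatible. -/
def gsConflicts (n m : ℕ) : Set (PropForm (GSVar n m)) :=
  {A | ∃ R o R' o', GSConflict R o R' o' ∧ A = incompatible (R, o) (R', o')}

theorem GSConflict.mem_gsConflicts {n m : ℕ} {R R' : GSProfile n m} {o o' : Fin m}
    (h : GSConflict R o R' o') : incompatible (R, o) (R', o') ∈ gsConflicts n m :=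
  ⟨_, _, _, _, h, rfl⟩

theorem polyDer_gsConflict : ∃ k, ∀ {n m : ℕ}, 1 ≤ n → 3 ≤ m → ∀ {R o R' o'},
    GSConflict R o R' o' →
      PolyDer (gsWeight n m) k (gsClauses n m) {incompatible (R, o) (R', o')} := by
  obtain ⟨k₁, h₁⟩ := schema_var (n := 2) [.disj (.neg (.var 0)) (.disj (.neg (.var 1)) .bot)]
    (.imp (.var 0) (.imp (.var 1) .bot)) (by simp [eval]; tauto)
  obtain ⟨k₂, h₂⟩ := schema_var (n := 3) [.disj (.neg (.var 2)) (.disj (.neg (.var 1)) .bot)]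
    (.imp (.var 2) (.imp (.var 0) (.imp (.var 1) .bot))) (by simp [eval]; tauto)
  obtain ⟨k₃, h₃⟩ := schema_var (n := 2) []
    (.imp (.neg (.var 0)) (.imp (.var 0) (.imp (.var 1) .bot))) (by simp [eval]; tauto)
  obtain ⟨k₄, h₄⟩ := bigDisj_cases
  refine ⟨k₁ + k₂ + k₃ + k₄ + 16, fun {n m} hn hm R o R' o' h => ?_⟩
  have hw := two_le_gsWeight hn hm
  rcases h with ⟨rfl, h⟩ | ⟨i, π, rfl, h⟩
  · exact (h₁ ![(R, o), (R, o')] (unique_mem_gsClauses R h)).le (by omega)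
  · refine (h₄ (l := k₂ + k₃) (b := 4) _ _ (strategyproof_mem_gsClauses R o i π) ?_ ?_
      (size_incompatible hw _ _)).le (by omega)
    · simp only [List.forall_mem_cons, List.forall_mem_map, List.mem_filter]
      refine ⟨(h₃ ![(R, o), (_, o')] trivial).le (by omega), fun o₂ ho₂ => ?_⟩
      -- The disjuncts of the clause are outcomes that `i` ranks no higher than `o`, whereas `o'` is
      -- strictly better. So each of them excludes `o'` by uniqueness.
      have hne : o₂ ≠ o' := by
        rintro rfl
        exact absurd (by simpa using ho₂) (not_le.2 h)
      exact (h₂ ![(R, o), (_, o'), (Function.update R i π, o₂)]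
        (unique_mem_gsClauses _ hne)).le (by omega)
    · refine size_bigDisj_le_pow hw (by simp [size]) ?_
      simp only [List.length_cons, List.length_map]
      have := List.length_filter_le (fun o' => decide ((R i).symm o ≤ (R i).symm o'))
        (List.finRange m)
      have := objects_le_gsWeight (m := m) hn
      simp at *
      omega

theorem polyDer_gsConflicts : ∃ k, ∀ {n m : ℕ}, 1 ≤ n → 3 ≤ m →
    PolyDer (gsWeight n m) k (gsClauses n m) (gsConflicts n m) := by
  obtain ⟨k, hk⟩ := polyDer_gsConflict
  refine ⟨4 + k, fun {n m} hn hm => of_range (ι := GSVar n m × GSVar n m)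
    (fun t => incompatible t.1 t.2) (card_gsVar_prod_le hn) ?_ ?_⟩
  · rintro _ ⟨R, o, R', o', -, rfl⟩
    exact ⟨((R, o), (R', o')), rfl⟩
  · rintro _ ⟨R, o, R', o', h, rfl⟩
    exact hk hn hm h

open PropForm PolyDer

/-! ### Monotonicity -/

/-- Either `o'` is better than `o` under `R i`, and then `i` gains by reporting `π`; or it is worse,
hence still worse under `π`, and then an agent with true ranking `π` gains by reporting `R i`. -/
theorem GSConflict.of_liftsAt {n m : ℕ} {R : GSProfile n m} {i : Fin n} {π : Equiv.Perm (Fin m)}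
    {o o' : Fin m} (h : LiftsAt o (R i) π) (ho : o' ≠ o) :
    GSConflict R o (Function.update R i π) o' ∨ GSConflict (Function.update R i π) o' R o := by
  rcases lt_or_ge ((R i).symm o') ((R i).symm o) with hlt | hle
  · exact Or.inl (Or.inr ⟨i, π, rfl, hlt⟩)
  · refine Or.inr (Or.inr ⟨i, R i, by simp, ?_⟩)
    rw [Function.update_self]
    exact lt_of_le_of_ne (h o' hle) fun h => ho ((Equiv.injective _ h).symm)

theorem polyDer_lift_one : ∃ k, ∀ {n m : ℕ}, 1 ≤ n → 3 ≤ m → ∀ {R : GSProfile n m} {i π o},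
    LiftsAt o (R i) π → PolyDer (gsWeight n m) k (gsClauses n m ∪ gsConflicts n m)
      {imp (var (R, o)) (var (Function.update R i π, o))} := by
  obtain ⟨k₁, h₁⟩ := schema_var (n := 2) [] (.imp (.var 0) (.imp (.var 1) (.var 0)))
    (by simp [eval]; tauto)
  obtain ⟨k₂, h₂⟩ := schema_var (n := 3) [incompatible 0 1]
    (.imp (.var 0) (.imp (.var 1) (.var 2))) (by simp [eval]; tauto)
  obtain ⟨k₃, h₃⟩ := schema_var (n := 3) [incompatible 1 0]
    (.imp (.var 0) (.imp (.var 1) (.var 2))) (by simp [eval]; tauto)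
  obtain ⟨k₄, h₄⟩ := bigDisj_cases
  refine ⟨k₁ + k₂ + k₃ + k₄ + 16, fun {n m} hn hm R i π o h => ?_⟩
  have hw := two_le_gsWeight hn hm
  refine (h₄ (l := k₁ + k₂ + k₃) (b := 4) _ _ (Or.inl (total_mem_gsClauses
    (Function.update R i π))) ?_ ?_ ?_).le (by omega)
  · simp only [List.forall_mem_map]
    intro o' _
    by_cases ho : o' = o
    · subst ho
      exact (h₁ ![(Function.update R i π, o'), (R, o')] trivial).le (by omega)
    · rcases GSConflict.of_liftsAt h ho with h | h
      all_goals have hc := Set.mem_union_right (gsClauses n m) h.mem_gsConflicts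
      · exact (h₃ ![(Function.update R i π, o'), (R, o), (Function.update R i π, o)] hc).le
          (by omega)
      · exact (h₂ ![(Function.update R i π, o'), (R, o), (Function.update R i π, o)] hc).le
          (by omega)
  · refine size_bigDisj_le_pow hw (by simp [size]) ?_
    have := objects_le_gsWeight (m := m) hn
    simp
    omega
  · have := Nat.pow_le_pow_left hw 4
    simp only [size]
    omega

/-- The formulas expressing monotonicity. -/
def gsLifts (n m : ℕ) : Set (PropForm (GSVar n m)) :=
  {A | ∃ R R' o, Lifts o R R' ∧ A = imp (var (R, o)) (var (R', o))}

theorem polyDer_lift : ∃ k, ∀ {n m : ℕ}, 1 ≤ n → 3 ≤ m → ∀ {R R' : GSProfile n m} {o},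
    Lifts o R R' → PolyDer (gsWeight n m) k (gsClauses n m ∪ gsConflicts n m)
      {imp (var (R, o)) (var (R', o))} := by
  obtain ⟨k₁, h₁⟩ := schema_var (n := 1) [] (.imp (.var 0) (.var 0)) (by simp [eval])
  obtain ⟨k₂, h₂⟩ := schema_var (n := 3) [.imp (.var 0) (.var 1), .imp (.var 1) (.var 2)]
    (.imp (.var 0) (.var 2)) (by simp [eval]; tauto)
  obtain ⟨k₃, h₃⟩ := polyDer_lift_one
  refine ⟨k₁ + (k₃ + k₂ + 1) + 1 + 1, fun {n m} hn hm R R' o h => ?_⟩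
  -- In `mix j` the first `j` agents have switched to their rankings in `R'`. Changing one agent at
  -- a time gives a chain of length `n ≤ w`.
  set mix : ℕ → GSProfile n m := fun j i => if i.val < j then R' i else R i with hmix
  have hR : mix 0 = R := by ext; simp [hmix]
  have hR' : mix n = R' := by ext i; simp [hmix]
  have key := chain (w := gsWeight n m) (a := 1) (k := k₁ + (k₃ + k₂ + 1))
    (Γ := gsClauses n m ∪ gsConflicts n m)
    (fun j => imp (var (R, o)) (var (mix j, o))) (N := n) (by simpa using agents_le_gsWeight hm)
    ?_ ?_
  · rwa [hR'] at key
  · simp only [hR]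
    exact (h₁ ![(R, o)] trivial).le (by omega)
  · intro j hj
    have hstep : mix (j + 1) = Function.update (mix j) ⟨j, hj⟩ (R' ⟨j, hj⟩) := by
      funext i
      rcases eq_or_ne i ⟨j, hj⟩ with rfl | hi
      · simp [hmix]
      · have : i.val ≠ j := fun h => hi (Fin.ext h)
        rw [Function.update_of_ne hi]
        simp only [hmix]
        by_cases h : i.val < j
        · rw [if_pos h, if_pos (by omega)]
        · rw [if_neg h, if_neg (by omega)]
    have hl : LiftsAt o (mix j ⟨j, hj⟩) (R' ⟨j, hj⟩) := by simpa [hmix] using h ⟨j, hj⟩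
    have h₄ := (h₃ hn hm hl).monoLeft (Set.subset_union_left
      (t := {imp (var (R, o)) (var (mix j, o))}))
    have h₅ := h₄.trans (h₂ ![(R, o), (mix j, o), (mix (j + 1), o)]
      ⟨Or.inl (Or.inr rfl), Or.inr (by rw [hstep]; rfl)⟩)
    exact h₅.le (by omega)

theorem polyDer_gsLifts : ∃ k, ∀ {n m : ℕ}, 1 ≤ n → 3 ≤ m →
    PolyDer (gsWeight n m) k (gsClauses n m ∪ gsConflicts n m) (gsLifts n m) := by
  obtain ⟨k, hk⟩ := polyDer_lift
  refine ⟨4 + k, fun {n m} hn hm => of_range (ι := GSVar n m × GSVar n m)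
    (fun t => imp (var t.1) (var t.2)) (card_gsVar_prod_le hn) ?_ ?_⟩
  · rintro _ ⟨R, R', o, -, rfl⟩
    exact ⟨((R, o), (R', o)), rfl⟩
  · rintro _ ⟨R, R', o, h, rfl⟩
    exact hk hn hm h

/-! ### Unanimity and the Pareto principle -/

/-- The formulas expressing unanimity. -/
def gsUnanimity (n m : ℕ) : Set (PropForm (GSVar n m)) :=
  {A | ∃ R o, (∀ i, IsTopObject (R i) o) ∧ A = var (R, o)}

/-- By surjectivity `o` wins somewhere, and moving from there to `R`, where `o` is on top for
everybody, lifts `o`. -/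
theorem polyDer_unanimity : ∃ k, ∀ {n m : ℕ}, 1 ≤ n → 3 ≤ m → ∀ {R : GSProfile n m} {o},
    (∀ i, IsTopObject (R i) o) → PolyDer (gsWeight n m) k (gsClauses n m ∪ gsLifts n m)
      {var (R, o)} := by
  obtain ⟨k, hk⟩ := bigDisj_cases
  refine ⟨k + 2 + 16, fun {n m} hn hm R o h => ?_⟩
  have hw := two_le_gsWeight hn hm
  have hw4 := Nat.pow_le_pow_left hw 4
  refine (hk (l := 2) (b := 4) _ _ (Or.inl (onto_mem_gsClauses o)) ?_ ?_ ?_).le (by omega)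
  · simp only [List.forall_mem_map]
    intro R' _
    refine hyp (Or.inr ⟨R', R, o, fun i o' _ => h i o', rfl⟩) ?_
    have := Nat.pow_le_pow_left hw 2
    simp only [size]
    omega
  · refine size_bigDisj_le_pow hw (by simp [size]) ?_
    simp [length_gsProfiles]
  · simp only [size]
    omega

theorem polyDer_gsUnanimity : ∃ k, ∀ {n m : ℕ}, 1 ≤ n → 3 ≤ m →
    PolyDer (gsWeight n m) k (gsClauses n m ∪ gsLifts n m) (gsUnanimity n m) := by
  obtain ⟨k, hk⟩ := polyDer_unanimity
  refine ⟨2 + k, fun {n m} hn hm => of_range (ι := GSVar n m) var (card_gsVar_le hn) ?_ ?_⟩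
  · rintro _ ⟨R, o, -, rfl⟩
    exact ⟨(R, o), rfl⟩
  · rintro _ ⟨R, o, h, rfl⟩
    exact hk hn hm h

/-- The formulas expressing that Pareto-dominated objects are no outcomes. -/
def gsPareto (n m : ℕ) : Set (PropForm (GSVar n m)) :=
  {A | ∃ (R : GSProfile n m) (a b : Fin m), (∀ i, (R i).symm a < (R i).symm b) ∧
    A = imp (var (R, b)) bot}

/-- If `b` won at `R`, it would still win when every agent ranks `a`, `b` on top, but there
unanimity selects `a`. -/
theorem polyDer_pareto : ∃ k, ∀ {n m : ℕ}, 1 ≤ n → 3 ≤ m → ∀ {R : GSProfile n m} {a b},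
    (∀ i, (R i).symm a < (R i).symm b) →
      PolyDer (gsWeight n m) k (gsConflicts n m ∪ gsLifts n m ∪ gsUnanimity n m)
      {imp (var (R, b)) bot} := by
  obtain ⟨k, hk⟩ := schema_var (n := 3) [.imp (.var 0) (.var 1), incompatible 1 2, .var 2]
    (.imp (.var 0) .bot) (by simp [eval]; tauto)
  refine ⟨k, fun {n m} hn hm R a b h => ?_⟩
  have hab : b ≠ a := by
    rintro rfl
    exact (h ⟨0, hn⟩).ne rfl
  exact hk ![(R, b), (fun _ => topTwo a b, b), (fun _ => topTwo a b, a)]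
    ⟨Or.inl (Or.inr ⟨_, _, _, fun i => LiftsAt.of_lt (h i), rfl⟩),
      Or.inl (Or.inl ⟨_, _, _, _, Or.inl ⟨rfl, hab⟩, rfl⟩),
      Or.inr ⟨_, _, fun i => topTwo_fst_le a b, rfl⟩⟩

theorem polyDer_gsPareto : ∃ k, ∀ {n m : ℕ}, 1 ≤ n → 3 ≤ m →
    PolyDer (gsWeight n m) k (gsConflicts n m ∪ gsLifts n m ∪ gsUnanimity n m) (gsPareto n m) := by
  obtain ⟨k, hk⟩ := polyDer_pareto
  refine ⟨2 + k, fun {n m} hn hm => of_range (ι := GSVar n m) (fun x => imp (var x) bot)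
    (card_gsVar_le hn) ?_ ?_⟩
  · rintro _ ⟨R, a, b, -, rfl⟩
    exact ⟨(R, b), rfl⟩
  · rintro _ ⟨R, a, b, h, rfl⟩
    exact hk hn hm h

/-- The clauses together with the formulas expressing monotonicity, unanimity and the Pareto
principle. -/
def gsFacts (n m : ℕ) : Set (PropForm (GSVar n m)) :=
  gsClauses n m ∪ gsConflicts n m ∪ gsLifts n m ∪ gsUnanimity n m ∪ gsPareto n m

theorem gsClauses_subset_gsFacts (n m : ℕ) : gsClauses n m ⊆ gsFacts n m :=
  fun _ h => Or.inl (Or.inl (Or.inl (Or.inl h)))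

theorem gsConflicts_subset_gsFacts (n m : ℕ) : gsConflicts n m ⊆ gsFacts n m :=
  fun _ h => Or.inl (Or.inl (Or.inl (Or.inr h)))

theorem gsLifts_subset_gsFacts (n m : ℕ) : gsLifts n m ⊆ gsFacts n m :=
  fun _ h => Or.inl (Or.inl (Or.inr h))

theorem gsUnanimity_subset_gsFacts (n m : ℕ) : gsUnanimity n m ⊆ gsFacts n m :=
  fun _ h => Or.inl (Or.inr h)

theorem gsPareto_subset_gsFacts (n m : ℕ) : gsPareto n m ⊆ gsFacts n m := fun _ h => Or.inr h

/-- What can be derived from the facts can be derived from the clauses. -/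
theorem polyDer_of_gsFacts : ∃ k, ∀ {n m : ℕ}, 1 ≤ n → 3 ≤ m →
    ∀ {l : ℕ} {Γ Θ : Set (PropForm (GSVar n m))}, gsClauses n m ⊆ Γ →
      PolyDer (gsWeight n m) l (Γ ∪ gsFacts n m) Θ → PolyDer (gsWeight n m) (k + l) Γ Θ := by
  obtain ⟨k₁, h₁⟩ := polyDer_gsConflicts
  obtain ⟨k₂, h₂⟩ := polyDer_gsLifts
  obtain ⟨k₃, h₃⟩ := polyDer_gsUnanimity
  obtain ⟨k₄, h₄⟩ := polyDer_gsPareto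
  refine ⟨k₁ + k₂ + k₃ + k₄ + 4, fun {n m} hn hm l Γ Θ hΓ hΘ => ?_⟩
  have h := (((h₁ hn hm).monoLeft hΓ).cut ((h₂ hn hm).monoLeft
    (Set.union_subset_union_left _ hΓ))).cut ((h₃ hn hm).monoLeft ?_)
  · have h' := h.cut ((h₄ hn hm).monoLeft ?_)
    · refine (h'.trans (hΘ.monoLeft ?_)).le (by omega)
      rintro A (hA | ((((hA | hA) | hA) | hA) | hA))
      · exact Or.inl hA
      · exact Or.inl (hΓ hA)
      all_goals simp only [Set.mem_union]; tauto
    · intro A hA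
      simp only [Set.mem_union] at *
      tauto
  · rintro A (hA | hA)
    · exact Or.inl (hΓ hA)
    · exact Or.inr (Or.inr hA)

open PropForm PolyDer

/-! ### Decisive coalitions -/

/-- The outcome is decided by the coalition `A` when it ranks `a`, `b` on top and the others rank
`b`, `a` on top. -/
abbrev gsDecisive {n m : ℕ} (A : Finset (Fin n)) (a b : Fin m) : GSVar n m := (opposed A a b, a)

/-- Distinction of cases according to the outcome at a profile. -/
theorem polyDer_outcome_cases' : ∃ k, ∀ {n m : ℕ}, 1 ≤ n → 3 ≤ m → ∀ {l : ℕ}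
    {Γ : Set (PropForm (GSVar n m))} (R : GSProfile n m) (B : PropForm (GSVar n m)),
    gsClauses n m ⊆ Γ → B.size ≤ gsWeight n m ^ 8 →
      (∀ o, PolyDer (gsWeight n m) l Γ {imp (var (R, o)) B}) →
        PolyDer (gsWeight n m) (k + l) Γ {B} := by
  obtain ⟨k, hk⟩ := bigDisj_cases
  refine ⟨k + 32, fun {n m} hn hm l Γ R B hΓ hB h => ?_⟩
  have hR := total_mem_gsClauses R
  refine (hk (l := l) (b := 8) _ _ (hΓ hR) ?_ (size_le_of_mem_gsFormula hn hm hR) hB).le (by omega)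
  simpa only [List.forall_mem_map] using fun o _ => h o

/-- The form for conclusions of bounded size; `256 = 2 ^ 8` is at most `w ^ 8`. -/
theorem polyDer_outcome_cases : ∃ k, ∀ {n m : ℕ}, 1 ≤ n → 3 ≤ m → ∀ {l : ℕ}
    {Γ : Set (PropForm (GSVar n m))} (R : GSProfile n m) (B : PropForm (GSVar n m)),
    gsClauses n m ⊆ Γ → B.size ≤ 256 → (∀ o, PolyDer (gsWeight n m) l Γ {imp (var (R, o)) B}) →
      PolyDer (gsWeight n m) (k + l) Γ {B} := by
  obtain ⟨k, hk⟩ := polyDer_outcome_cases'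
  exact ⟨k, fun hn hm _ _ R B hΓ hB h => hk hn hm R B hΓ
    (hB.trans (Nat.pow_le_pow_left (two_le_gsWeight hn hm) 8)) h⟩

theorem Lifts.mem_gsFacts {n m : ℕ} {R R' : GSProfile n m} {o : Fin m} (h : Lifts o R R') :
    imp (var (R, o)) (var (R', o)) ∈ gsFacts n m :=
  gsLifts_subset_gsFacts n m ⟨_, _, _, h, rfl⟩

theorem incompatible_mem_gsFacts {n m : ℕ} (R : GSProfile n m) {o o' : Fin m} (h : o ≠ o') :
    incompatible (R, o) (R, o') ∈ gsFacts n m :=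
  gsConflicts_subset_gsFacts n m (GSConflict.mem_gsConflicts (Or.inl ⟨rfl, h⟩))

theorem pareto_mem_gsFacts {n m : ℕ} {R : GSProfile n m} {a b : Fin m}
    (h : ∀ i, (R i).symm a < (R i).symm b) : imp (var (R, b)) bot ∈ gsFacts n m :=
  gsPareto_subset_gsFacts n m ⟨_, _, _, h, rfl⟩

theorem unanimity_mem_gsFacts {n m : ℕ} {R : GSProfile n m} {o : Fin m}
    (h : ∀ i, IsTopObject (R i) o) : var (R, o) ∈ gsFacts n m :=
  gsUnanimity_subset_gsFacts n m ⟨_, _, h, rfl⟩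

theorem decisive_univ_mem_gsFacts {n m : ℕ} (a b : Fin m) :
    var (gsDecisive Finset.univ a b) ∈ gsFacts n m :=
  unanimity_mem_gsFacts fun i => by
    simpa [opposed, IsTopObject] using topTwo_fst_le a b

/-- Decisive coalitions meet in decisive coalitions. -/
theorem polyDer_decisive_inter : ∃ k, ∀ {n m : ℕ}, 1 ≤ n → 3 ≤ m → ∀ (A B : Finset (Fin n))
    {a b c : Fin m}, a ≠ b → a ≠ c → b ≠ c → PolyDer (gsWeight n m) k (gsFacts n m)
      {imp (var (gsDecisive A a b)) (imp (var (gsDecisive B b c))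
        (var (gsDecisive (A ∩ B) a c)))} := by
  obtain ⟨k₁, h₁⟩ := schema_var (n := 4) [.imp (.var 0) (.var 3)]
    (.imp (.var 0) (.imp (.var 1) (.imp (.var 2) (.var 3)))) (by simp [eval]; tauto)
  obtain ⟨k₂, h₂⟩ := schema_var (n := 5) [.imp (.var 0) (.var 4), incompatible 4 1]
    (.imp (.var 0) (.imp (.var 1) (.imp (.var 2) (.var 3)))) (by simp [eval]; tauto)
  obtain ⟨k₃, h₃⟩ := schema_var (n := 5) [.imp (.var 0) (.var 4), incompatible 4 2]
    (.imp (.var 0) (.imp (.var 1) (.imp (.var 2) (.var 3)))) (by simp [eval]; tauto)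
  obtain ⟨k₄, h₄⟩ := schema_var (n := 4) [.imp (.var 0) .bot]
    (.imp (.var 0) (.imp (.var 1) (.imp (.var 2) (.var 3)))) (by simp [eval]; tauto)
  obtain ⟨k₅, h₅⟩ := polyDer_outcome_cases
  refine ⟨k₅ + (k₁ + k₂ + k₃ + k₄), fun {n m} hn hm A B {a b c} hab hac hbc => ?_⟩
  -- Distinguish the outcome at the Condorcet profile. If it is `a`, lifting makes `A ∩ B` decisive;
  -- `b` contradicts decisiveness of `A`, and `c` that of `B`; every other object is
  -- Pareto-dominated by `a`.
  refine h₅ hn hm (condorcet A B a b c) _ (gsClauses_subset_gsFacts n m) (by simp [size])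
    fun o => ?_
  by_cases ha : o = a
  · subst ha
    exact (h₁ ![(condorcet A B o b c, o), gsDecisive A o b, gsDecisive B b c,
      gsDecisive (A ∩ B) o c] (lifts_condorcet_fst A B hab hac hbc).mem_gsFacts).le (by omega)
  by_cases hb : o = b
  · subst hb
    exact (h₂ ![(condorcet A B a o c, o), gsDecisive A a o, gsDecisive B o c,
      gsDecisive (A ∩ B) a c, (opposed A a o, o)]
      ⟨(lifts_condorcet_snd A B hab hac hbc).mem_gsFacts, incompatible_mem_gsFacts _ ha⟩).le
      (by omega)
  by_cases hc : o = c
  · subst hc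
    exact (h₃ ![(condorcet A B a b o, o), gsDecisive A a b, gsDecisive B b o,
      gsDecisive (A ∩ B) a o, (opposed B b o, o)]
      ⟨(lifts_condorcet_trd A B hab hac hbc).mem_gsFacts, incompatible_mem_gsFacts _ hb⟩).le
      (by omega)
  · exact (h₄ ![(condorcet A B a b c, o), gsDecisive A a b, gsDecisive B b c,
      gsDecisive (A ∩ B) a c]
      (pareto_mem_gsFacts (condorcet_lt A B hab hac ha hb hc))).le (by omega)

/-- Intersect `A` with the coalition of all agents, which is decisive for `(b, c)` by unanimity. The
next lemma changes the first object by intersecting on the other side. -/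
theorem polyDer_decisive_snd : ∃ k, ∀ {n m : ℕ}, 1 ≤ n → 3 ≤ m → ∀ (A : Finset (Fin n))
    {a b c : Fin m}, a ≠ b → a ≠ c → PolyDer (gsWeight n m) k (gsFacts n m)
      {imp (var (gsDecisive A a b)) (var (gsDecisive A a c))} := by
  obtain ⟨k₁, h₁⟩ := schema_var (n := 1) [] (.imp (.var 0) (.var 0)) (by simp [eval])
  obtain ⟨k₂, h₂⟩ := schema_var (n := 3) [.var 1, .imp (.var 0) (.imp (.var 1) (.var 2))]
    (.imp (.var 0) (.var 2)) (by simp [eval]; tauto)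
  obtain ⟨k₃, h₃⟩ := polyDer_decisive_inter
  refine ⟨k₁ + k₂ + k₃ + 1, fun {n m} hn hm A {a b c} hab hac => ?_⟩
  by_cases hbc : b = c
  · subst hbc
    exact (h₁ ![gsDecisive A a b] trivial).le (by omega)
  · have := h₃ hn hm A Finset.univ hab hac hbc
    rw [Finset.inter_univ] at this
    exact (this.trans (h₂ ![gsDecisive A a b, gsDecisive Finset.univ b c, gsDecisive A a c]
      ⟨Or.inl (decisive_univ_mem_gsFacts b c), Or.inr rfl⟩)).le (by omega)

theorem polyDer_decisive_fst : ∃ k, ∀ {n m : ℕ}, 1 ≤ n → 3 ≤ m → ∀ (A : Finset (Fin n))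
    {a b c : Fin m}, a ≠ b → c ≠ b → PolyDer (gsWeight n m) k (gsFacts n m)
      {imp (var (gsDecisive A a b)) (var (gsDecisive A c b))} := by
  obtain ⟨k₁, h₁⟩ := schema_var (n := 1) [] (.imp (.var 0) (.var 0)) (by simp [eval])
  obtain ⟨k₂, h₂⟩ := schema_var (n := 3) [.var 1, .imp (.var 1) (.imp (.var 0) (.var 2))]
    (.imp (.var 0) (.var 2)) (by simp [eval]; tauto)
  obtain ⟨k₃, h₃⟩ := polyDer_decisive_inter
  refine ⟨k₁ + k₂ + k₃ + 1, fun {n m} hn hm A {a b c} hab hcb => ?_⟩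
  by_cases hca : c = a
  · subst hca
    exact (h₁ ![gsDecisive A c b] trivial).le (by omega)
  · have := h₃ hn hm Finset.univ A hca hcb hab
    rw [Finset.univ_inter] at this
    exact (this.trans (h₂ ![gsDecisive A a b, gsDecisive Finset.univ c a, gsDecisive A c b]
      ⟨Or.inl (decisive_univ_mem_gsFacts c a), Or.inr rfl⟩)).le (by omega)

theorem exists_imp_trans : ∃ k, ∀ {V : Type} {w l l' : ℕ} {Γ : Set (PropForm V)} {x y z : V},
    PolyDer w l Γ {imp (var x) (var y)} → PolyDer w l' Γ {imp (var y) (var z)} →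
      PolyDer w (k + l + l') Γ {imp (var x) (var z)} := by
  obtain ⟨k, hk⟩ := schema_var (n := 3) [.imp (.var 0) (.var 1), .imp (.var 1) (.var 2)]
    (.imp (.var 0) (.var 2)) (by simp [eval]; tauto)
  exact ⟨k + 2, fun {V w l l' Γ x y z} h₁ h₂ => ((h₁.union h₂).trans (hk ![x, y, z]
    ⟨Or.inr (Or.inl rfl), Or.inr (Or.inr rfl)⟩)).le (by omega)⟩

theorem exists_third_object {m : ℕ} (hm : 3 ≤ m) (a b : Fin m) : ∃ c, c ≠ a ∧ c ≠ b := by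
  have : ({a, b} : Finset (Fin m)).card < Fintype.card (Fin m) := by
    have := Finset.card_le_two (a := a) (b := b)
    simp only [Fintype.card_fin]
    omega
  obtain ⟨c, hc⟩ := Finset.exists_mem_notMem_of_card_lt_card
    (this.trans_eq (Finset.card_univ (α := Fin m)).symm)
  exact ⟨c, by simpa using hc.2⟩

/-- Neutrality: decisiveness does not depend on the pair of objects. -/
theorem polyDer_decisive_neutral : ∃ k, ∀ {n m : ℕ}, 1 ≤ n → 3 ≤ m → ∀ (A : Finset (Fin n))
    {a b c d : Fin m}, a ≠ b → c ≠ d → PolyDer (gsWeight n m) k (gsFacts n m)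
      {imp (var (gsDecisive A a b)) (var (gsDecisive A c d))} := by
  obtain ⟨k₁, h₁⟩ := polyDer_decisive_fst
  obtain ⟨k₂, h₂⟩ := polyDer_decisive_snd
  obtain ⟨k₃, h₃⟩ := exists_imp_trans
  refine ⟨2 * (k₁ + k₂ + k₃) + k₃, fun {n m} hn hm A {a b c d} hab hcd => ?_⟩
  have key : ∀ {a b c d : Fin m}, a ≠ b → c ≠ b → c ≠ d → PolyDer (gsWeight n m) (k₃ + k₁ + k₂)
      (gsFacts n m) {imp (var (gsDecisive A a b)) (var (gsDecisive A c d))} :=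
    fun hab hcb hcd => h₃ (h₁ hn hm A hab hcb) (h₂ hn hm A hcb hcd)
  by_cases hcb : c = b
  · subst hcb
    -- The direct route needs `c ≠ b`. Otherwise a third object `e` permits the detour through the
    -- pair `(a, e)`.
    obtain ⟨e, hea, hec⟩ := exists_third_object hm a c
    exact (h₃ (key hab hab hea.symm) (key hea.symm hec.symm hcd)).le (by omega)
  · exact (key hab hcb hcd).le (by omega)

/-- If another object `o` won at `R`, it would also win at `opposed {i} a o`, because `i` ranks `a`
above `o`. By neutrality `{i}` is decisive for `(a, o)`, so `a` wins there. -/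
theorem polyDer_dictator_outcome : ∃ k, ∀ {n m : ℕ}, 1 ≤ n → 3 ≤ m → ∀ {R : GSProfile n m}
    {i : Fin n} {a b c : Fin m}, b ≠ c → IsTopObject (R i) a →
      PolyDer (gsWeight n m) k (gsFacts n m)
        {imp (var (gsDecisive {i} b c)) (var (R, a))} := by
  obtain ⟨k₁, h₁⟩ := schema_var (n := 2) [] (.imp (.var 0) (.imp (.var 1) (.var 0)))
    (by simp [eval]; tauto)
  obtain ⟨k₂, h₂⟩ := schema_var (n := 5)
    [.imp (.var 0) (.var 1), incompatible 1 2, .imp (.var 3) (.var 2)]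
    (.imp (.var 0) (.imp (.var 3) (.var 4))) (by simp [eval]; tauto)
  obtain ⟨k₃, h₃⟩ := polyDer_outcome_cases
  obtain ⟨k₄, h₄⟩ := polyDer_decisive_neutral
  refine ⟨k₃ + (k₁ + k₂ + k₄ + 1), fun {n m} hn hm R i a b c hbc ha => ?_⟩
  refine h₃ hn hm R _ (gsClauses_subset_gsFacts n m) (by simp [size]) fun o => ?_
  by_cases ho : o = a
  · subst ho
    exact (h₁ ![(R, o), gsDecisive {i} b c] trivial).le (by omega)
  · have hl : Lifts o R (opposed {i} a o) := lifts_opposed fun j hj => by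
      rw [Finset.mem_singleton.1 hj]
      exact lt_of_le_of_ne (ha o) fun h => ho (Equiv.injective _ h).symm
    exact ((h₄ hn hm {i} hbc (Ne.symm ho)).trans (h₂ ![(R, o), (opposed {i} a o, o),
      gsDecisive {i} a o, gsDecisive {i} b c, (R, a)] ⟨Or.inl hl.mem_gsFacts,
        Or.inl (incompatible_mem_gsFacts _ ho), Or.inr rfl⟩)).le (by omega)

/-- No single agent is decisive. -/
theorem polyDer_singleton_not_decisive : ∃ k, ∀ {n m : ℕ}, 1 ≤ n → 3 ≤ m → ∀ (i : Fin n)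
    {a b : Fin m}, a ≠ b → PolyDer (gsWeight n m) k (gsFacts n m)
        {imp (var (gsDecisive {i} a b)) bot} := by
  classical
  obtain ⟨k₁, h₁⟩ := schema_var (n := 2) [.imp (.var 0) (.var 1)]
    (.imp (.neg (.var 1)) (.imp (.var 0) .bot)) (by simp [eval]; tauto)
  obtain ⟨k₂, h₂⟩ := bigDisj_cases
  obtain ⟨k₃, h₃⟩ := polyDer_dictator_outcome
  refine ⟨k₁ + k₂ + k₃ + 50, fun {n m} hn hm i a b hab => ?_⟩
  have hw := two_le_gsWeight hn hm
  refine (h₂ (l := k₁ + k₃ + 1) (b := 8) _ _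
    (gsClauses_subset_gsFacts n m (nondict_mem_gsClauses i)) ?_ ?_ ?_).le (by omega)
  · simp only [List.mem_flatMap, List.mem_map, List.mem_filter]
    rintro _ ⟨R, -, o, ⟨-, ho⟩, rfl⟩
    have := h₃ hn hm (R := R) hab (by simpa using ho)
    exact (this.trans (h₁ ![gsDecisive {i} a b, (R, o)] (Or.inr rfl))).le (by omega)
  · exact size_le_of_mem_gsFormula hn hm (nondict_mem_gsClauses i)
  · have := Nat.pow_le_pow_left hw 8
    simp only [size]
    omega

/-- Complements of single agents are decisive. -/
theorem polyDer_compl_decisive : ∃ k, ∀ {n m : ℕ}, 1 ≤ n → 3 ≤ m → ∀ (i : Fin n)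
    {a b : Fin m}, a ≠ b → PolyDer (gsWeight n m) k (gsFacts n m)
        {var (gsDecisive {i}ᶜ b a)} := by
  obtain ⟨k₁, h₁⟩ := schema_var (n := 2) [.imp (.var 0) .bot]
    (.imp (.var 0) (.var 1)) (by simp [eval]; tauto)
  obtain ⟨k₂, h₂⟩ := schema_var (n := 1) [] (.imp (.var 0) (.var 0)) (by simp [eval])
  obtain ⟨k₃, h₃⟩ := polyDer_outcome_cases
  obtain ⟨k₄, h₄⟩ := polyDer_singleton_not_decisive
  refine ⟨k₃ + (k₁ + k₂ + k₄ + 1), fun {n m} hn hm i a b hab => ?_⟩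
  -- The profile is `opposed {i} a b` seen from the complement. The Pareto principle leaves `a` and
  -- `b` as outcomes there, and `a` would make `{i}` decisive.
  rw [gsDecisive, opposed_compl]
  refine h₃ hn hm (opposed {i} a b) _ (gsClauses_subset_gsFacts n m) (by simp [size]) fun o => ?_
  by_cases ha : o = a
  · subst ha
    exact ((h₄ hn hm i hab).trans
      (h₁ ![gsDecisive {i} o b, (opposed {i} o b, b)] (Or.inr rfl))).le (by omega)
  by_cases hb : o = b
  · subst hb
    exact (h₂ ![(opposed {i} a o, o)] trivial).le (by omega)
  · have hlt : ∀ j, (opposed {i} a b j).symm a < (opposed {i} a b j).symm o := fun j => by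
      refine lt_of_le_of_ne ?_ fun h => ha (Equiv.injective _ h).symm
      by_cases hj : j ∈ ({i} : Finset (Fin n))
      · simpa only [opposed, if_pos hj] using topTwo_fst_le a b o
      · simpa only [opposed, if_neg hj] using topTwo_snd_le hab.symm hb
    exact (h₁ ![(opposed {i} a b, o), (opposed {i} a b, b)] (pareto_mem_gsFacts hlt)).le (by omega)

/-- The clauses of `GS_{n,m}` have refutations of polynomial size. -/
theorem polyDer_bot : ∃ k, ∀ {n m : ℕ}, 1 ≤ n → 3 ≤ m →
    PolyDer (gsWeight n m) k (gsFacts n m) {(bot : PropForm (GSVar n m))} := by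
  obtain ⟨k₁, h₁⟩ := schema_var (n := 5) [.var 0, .var 1,
    .imp (.var 0) (.imp (.var 1) (.var 2)), .imp (.var 2) (.var 3)] (.var 3) (by simp [eval]; tauto)
  obtain ⟨k₂, h₂⟩ := schema_var (n := 2) [.var 0, .var 1, incompatible 0 1] .bot (by simp [eval]; tauto)
  obtain ⟨k₃, h₃⟩ := polyDer_decisive_inter
  obtain ⟨k₄, h₄⟩ := polyDer_decisive_neutral
  obtain ⟨k₅, h₅⟩ := polyDer_compl_decisive
  refine ⟨k₁ + k₂ + k₃ + k₄ + k₅ + 20, fun {n m} hn hm => ?_⟩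
  let o₀ : Fin m := ⟨0, by omega⟩
  let o₁ : Fin m := ⟨1, by omega⟩
  let o₂ : Fin m := ⟨2, by omega⟩
  have h01 : o₀ ≠ o₁ := by simp [o₀, o₁]
  have h02 : o₀ ≠ o₂ := by simp [o₀, o₂]
  have h12 : o₁ ≠ o₂ := by simp [o₂, o₁]
  have hw := two_le_gsWeight hn hm
  -- `S j` consists of the agents from `j` on, so `S 0` is everybody and `S n` is empty. Each link
  -- removes one agent by intersecting with the complement of `{j}`.
  let S : ℕ → Finset (Fin n) := fun j => Finset.univ.filter fun i => j ≤ i.val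
  have hS : ∀ j (hj : j < n), S j ∩ {⟨j, hj⟩}ᶜ = S (j + 1) := by
    intro j hj
    ext i
    simp only [S, Finset.mem_inter, Finset.mem_filter, Finset.mem_univ, true_and,
      Finset.mem_compl, Finset.mem_singleton, Fin.ext_iff]
    omega
  have key := chain (w := gsWeight n m) (a := 1) (k := k₁ + k₃ + k₄ + k₅ + 10)
    (Γ := gsFacts n m) (fun j => var (gsDecisive (S j) o₀ o₁)) (N := n)
    (by simpa using agents_le_gsWeight hm) ?_ ?_
  · have h0 : S n = ∅ := by
      ext i
      simp [S]
    simp only [h0] at key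
    refine (key.trans (h₂ ![gsDecisive ∅ o₀ o₁, gsDecisive Finset.univ o₁ o₀] ⟨Or.inr rfl,
      Or.inl (decisive_univ_mem_gsFacts _ _), ?_⟩)).le (by omega)
    -- At this common profile decisiveness of `∅` says that `o₀` wins, while unanimity says that
    -- `o₁` wins.
    have : opposed (Finset.univ : Finset (Fin n)) o₁ o₀ = opposed ∅ o₀ o₁ := by
      rw [← opposed_compl, Finset.compl_univ]
    simp only [gsDecisive, this]
    exact Or.inl (incompatible_mem_gsFacts _ h01)
  · have h0 : S 0 = Finset.univ := by
      ext i
      simp [S]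
    simp only [h0]
    exact hyp (decisive_univ_mem_gsFacts _ _) (Nat.one_le_pow _ _ (by omega))
  · intro j hj
    have e₁ := h₅ hn hm ⟨j, hj⟩ h12.symm
    have e₂ := h₃ hn hm (S j) {⟨j, hj⟩}ᶜ h01 h02 h12
    -- The intersection is decisive for `(o₀, o₂)` only; neutrality brings it back to `(o₀, o₁)` for
    -- the next link.
    have e₃ := h₄ hn hm (S (j + 1)) h02 h01
    rw [hS] at e₂
    have e := ((e₁.union e₂).union e₃).monoLeft (Set.subset_union_left
      (t := {var (gsDecisive (S j) o₀ o₁)}))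
    exact (e.trans (h₁ ![gsDecisive (S j) o₀ o₁, gsDecisive {⟨j, hj⟩}ᶜ o₁ o₂,
      gsDecisive (S (j + 1)) o₀ o₂, gsDecisive (S (j + 1)) o₀ o₁, gsDecisive (S (j + 1)) o₀ o₁]
      ⟨Or.inl (Or.inr rfl), Or.inr (Or.inl (Or.inl rfl)), Or.inr (Or.inl (Or.inr rfl)),
        Or.inr (Or.inr rfl)⟩)).le (by omega)

open PropForm PolyDer

/-! ### Restricting the objects and merging agents -/

theorem PropForm.subst_bigDisj {V W : Type} (s : W → PropForm V) (L : List (PropForm W)) :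
    (bigDisj L).subst s = bigDisj (L.map (subst s)) := by
  induction L with
  | nil => rfl
  | cons A L ih => simp only [bigDisj, subst, ih, List.map_cons]

theorem PropForm.subst_var {V : Type} (A : PropForm V) : A.subst var = A := by
  induction A <;> simp_all [subst]

/-- The ranking of `m` objects that starts with a given ranking of the first `m'` objects. -/
noncomputable def extendRanking {m m' : ℕ} (h : m' ≤ m) (π : Equiv.Perm (Fin m')) :
    Equiv.Perm (Fin m) :=
  π.viaEmbedding (Fin.castLEEmb h)

section

variable {m m' : ℕ} (h : m' ≤ m) (π : Equiv.Perm (Fin m'))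

theorem extendRanking_symm_castLE (o : Fin m') :
    (extendRanking h π).symm (Fin.castLE h o) = Fin.castLE h (π.symm o) := by
  rw [Equiv.symm_apply_eq]
  have := π.viaEmbedding_apply (Fin.castLEEmb h) (π.symm o)
  simpa [extendRanking] using this.symm

theorem extendRanking_symm_of_le {o : Fin m} (ho : m' ≤ o.val) :
    (extendRanking h π).symm o = o := by
  rw [Equiv.symm_apply_eq]
  refine (π.viaEmbedding_apply_of_notMem _ o ?_).symm
  rintro ⟨j, rfl⟩
  exact absurd j.isLt (not_lt.2 ho)

theorem extendRanking_castLE_lt (o : Fin m') {o' : Fin m} (ho : m' ≤ o'.val) :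
    (extendRanking h π).symm (Fin.castLE h o) < (extendRanking h π).symm o' := by
  rw [extendRanking_symm_castLE, extendRanking_symm_of_le h π ho, Fin.lt_def]
  exact (π.symm o).isLt.trans_le ho

theorem extendRanking_lt_iff (o o' : Fin m') :
    (extendRanking h π).symm (Fin.castLE h o) < (extendRanking h π).symm (Fin.castLE h o') ↔
      π.symm o < π.symm o' := by
  simp [extendRanking_symm_castLE]

theorem exists_castLE_or_le (o : Fin m) : (∃ o', o = Fin.castLE h o') ∨ m' ≤ o.val := by
  by_cases ho : o.val < m'
  · exact Or.inl ⟨⟨o, ho⟩, rfl⟩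
  · exact Or.inr (not_lt.1 ho)

theorem isTopObject_extendRanking {o : Fin m'} (ho : IsTopObject π o) :
    IsTopObject (extendRanking h π) (Fin.castLE h o) := by
  intro o'
  rcases exists_castLE_or_le h o' with ⟨o', rfl⟩ | ho'
  · rw [extendRanking_symm_castLE, extendRanking_symm_castLE]
    exact ho o'
  · exact (extendRanking_castLE_lt h π o ho').le

end

/-- The profile of `n` agents and `m` objects in which the agent `j` takes over the extended ranking
of the agent `φ j`. -/
noncomputable def extendProfile {n m n' m' : ℕ} (h : m' ≤ m) (φ : Fin n → Fin n')
    (R : GSProfile n' m') : GSProfile n m := fun j => extendRanking h (R (φ j))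

/-- The substitution that restricts a social choice function to the first `m'` objects and to the
profiles in which agents with the same image under `φ` have the same ranking. -/
noncomputable def restrictSubst {n m n' m' : ℕ} (h : m' ≤ m) (φ : Fin n → Fin n')
    (x : GSVar n' m') : PropForm (GSVar n m) :=
  var (extendProfile h φ x.1, Fin.castLE h x.2)

/-- The coalition of the agents that `φ` maps to `i`. -/
def agentFiber {n n' : ℕ} (φ : Fin n → Fin n') (i : Fin n') : Finset (Fin n) :=
  Finset.univ.filter fun j => φ j = i

theorem size_subst_restrictSubst {n m n' m' : ℕ} (h : m' ≤ m) (φ : Fin n → Fin n')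
    (A : PropForm (GSVar n' m')) : (A.subst (restrictSubst h φ)).size ≤ A.size := by
  simpa using A.size_subst_le (restrictSubst h φ) le_rfl fun x => le_rfl

/-- One agent's misreport becomes a simultaneous change of a whole fiber, so strategyproofness after
restriction is not an instance of a single original clause. -/
theorem extendProfile_update {n m n' m' : ℕ} (h : m' ≤ m) (φ : Fin n → Fin n')
    (R : GSProfile n' m') (i : Fin n') (π : Equiv.Perm (Fin m')) (j : Fin n) :
    extendProfile h φ (Function.update R i π) j =
      if φ j = i then extendRanking h π else extendProfile h φ R j := by
  by_cases hj : φ j = i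
  · simp [extendProfile, hj]
  · simp [extendProfile, hj]

theorem size_subst_le_of_mem_gsFormula {n m n' m' : ℕ} (hn : 1 ≤ n') (hm : 3 ≤ m') (hnn : n' ≤ n)
    (hmm : m' ≤ m) (φ : Fin n → Fin n') {A : PropForm (GSVar n' m')} (hA : A ∈ gsFormula n' m') :
    (A.subst (restrictSubst hmm φ)).size ≤ gsWeight n m ^ 8 :=
  (size_subst_restrictSubst hmm φ A).trans ((size_le_of_mem_gsFormula hn hm hA).trans
    (Nat.pow_le_pow_left (gsWeight_mono hnn hmm) 8))

/-- An outcome among the first `m'` objects has to be taken into account only. -/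
theorem polyDer_restricted_outcome_cases : ∃ k, ∀ {n m n' m' : ℕ}, 1 ≤ n' → 3 ≤ m' → n' ≤ n →
    ∀ (hmm : m' ≤ m) (φ : Fin n → Fin n') {l : ℕ} {Γ : Set (PropForm (GSVar n m))}
    (R : GSProfile n' m') (B : PropForm (GSVar n m)), gsFacts n m ⊆ Γ →
    B.size ≤ gsWeight n m ^ 8 →
    (∀ o, PolyDer (gsWeight n m) l Γ {imp (restrictSubst hmm φ (R, o)) B}) →
      PolyDer (gsWeight n m) (k + l) Γ {B} := by
  obtain ⟨k₁, h₁⟩ := polyDer_outcome_cases'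
  obtain ⟨k₂, h₂⟩ := schema (n := 2) [.imp (.var 0) .bot] (.imp (.var 0) (.var 1))
    (by simp [eval]; tauto)
  refine ⟨k₁ + (k₂ + 8), fun {n m n' m'} hn hm hnn hmm φ {l Γ} R B hΓ hB h => ?_⟩
  refine (h₁ (l := k₂ + 8 + l) (by omega) (by omega) (extendProfile hmm φ R) B
    ((gsClauses_subset_gsFacts n m).trans hΓ) hB fun o => ?_).le (by omega)
  rcases exists_castLE_or_le hmm o with ⟨o', rfl⟩ | ho
  · exact (h o').le (by omega)
  · have hp : imp (var (extendProfile hmm φ R, o)) bot ∈ Γ := hΓ (pareto_mem_gsFacts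
      (a := Fin.castLE hmm ⟨0, by omega⟩) fun j => extendRanking_castLE_lt hmm _ _ ho)
    refine (h₂ (b := 8) ![var (extendProfile hmm φ R, o), B] (List.forall_mem_singleton.2 hp)
      ?_).le (by omega)
    have hw := two_le_gsWeight (hn.trans hnn) (hm.trans hmm)
    simp only [Fin.forall_fin_two]
    exact ⟨Nat.one_le_pow _ _ (by omega), hB⟩

/-- If no fiber of `φ` is decisive, then the clauses of `GS_{n',m'}` for the restricted social
choice function can be derived. -/
theorem polyDer_restrict : ∃ k, ∀ {n m n' m' : ℕ}, 1 ≤ n' → 3 ≤ m' → n' ≤ n →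
    ∀ (hmm : m' ≤ m) (φ : Fin n → Fin n') {l : ℕ} {Γ : Set (PropForm (GSVar n m))},
    gsFacts n m ⊆ Γ → ∀ {a b : Fin m'}, a ≠ b →
    (∀ i, PolyDer (gsWeight n m) l Γ
      {imp (var (gsDecisive (agentFiber φ i) (Fin.castLE hmm a) (Fin.castLE hmm b))) bot}) →
    ∀ A ∈ gsFormula n' m', PolyDer (gsWeight n m) (k + l) Γ {A.subst (restrictSubst hmm φ)} := by
  classical
  obtain ⟨k₁, h₁⟩ := polyDer_restricted_outcome_cases
  obtain ⟨k₂, h₂⟩ := imp_bigDisj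
  obtain ⟨k₃, h₃⟩ := bigDisj_intro
  obtain ⟨k₄, h₄⟩ := schema_var (n := 2) [.imp (.var 0) (.var 1), .imp (.var 1) .bot]
    (.neg (.var 0)) (by simp [eval]; tauto)
  obtain ⟨k₅, h₅⟩ := schema_var (n := 4) [.imp (.var 0) (.var 1), .imp (.var 2) (.var 3),
    incompatible 1 3] (.imp (.var 0) (.neg (.var 2))) (by simp [eval]; tauto)
  obtain ⟨k₆, h₆⟩ := schema_var (n := 1) [] (.imp (.var 0) (.var 0)) (by simp [eval])
  refine ⟨k₁ + k₂ + k₃ + k₄ + k₅ + k₆ + 50,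
    fun {n m n' m'} hn hm hnn hmm φ {l Γ} hΓ {a b} hab hfiber A hA => ?_⟩
  have hw := two_le_gsWeight (hn.trans hnn) (hm.trans hmm)
  have hA8 := size_subst_le_of_mem_gsFormula hn hm hnn hmm φ hA
  have h1 : 1 ≤ gsWeight n m ^ 8 := Nat.one_le_pow _ _ (by omega)
  simp only [gsFormula, List.mem_append] at hA
  rcases hA with (((hA | hA) | hA) | hA) | hA
  · obtain ⟨R, -, rfl⟩ := List.mem_map.1 hA
    rw [subst_bigDisj] at hA8 ⊢
    refine (h₁ (l := k₆ + (k₂ + 16) + 1) hn hm hnn hmm φ R _ hΓ hA8 fun o => ?_).le (by omega)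
    have e := h₆ (Γ := Γ) (w := gsWeight n m) ![(extendProfile hmm φ R, Fin.castLE hmm o)] trivial
    refine (e.trans (h₂ (b := 8) _ _ (restrictSubst hmm φ (R, o)) ?_ (Or.inr rfl) hA8 h1)).le
      (by omega)
    exact List.mem_map.2 ⟨var (R, o), List.mem_map.2 ⟨o, by simp, rfl⟩, rfl⟩
  · simp only [gsUnique, List.mem_flatMap, List.mem_map, List.mem_filter] at hA
    obtain ⟨R, -, o₁, -, o₂, ⟨-, ho⟩, rfl⟩ := hA
    have hne : Fin.castLE hmm o₁ ≠ Fin.castLE hmm o₂ := by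
      simpa using ho
    exact (hyp (k := 8) (hΓ (gsClauses_subset_gsFacts n m
      (unique_mem_gsClauses (extendProfile hmm φ R) hne))) hA8).le (by omega)
  · obtain ⟨i, -, rfl⟩ := List.mem_map.1 hA
    rw [subst_bigDisj] at hA8 ⊢
    -- The witness against the dictator `i` is the profile `opposed {i} a b`: `i` has `a` on top,
    -- and if `a` won there, lifting would make the fiber of `i` decisive.
    have hlift : Lifts (Fin.castLE hmm a) (extendProfile hmm φ (opposed {i} a b))
        (opposed (agentFiber φ i) (Fin.castLE hmm a) (Fin.castLE hmm b)) := by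
      refine lifts_opposed' fun j hj => ?_
      have hj' : φ j ∉ ({i} : Finset (Fin n')) := by simpa [agentFiber] using hj
      refine (extendRanking_lt_iff hmm _ b a).2 ?_
      simp only [opposed, if_neg hj']
      exact lt_of_le_of_ne (topTwo_fst_le b a a) fun h => hab (Equiv.injective _ h).symm
    have e := (hfiber i).trans (h₄ ![(extendProfile hmm φ (opposed {i} a b), Fin.castLE hmm a),
      gsDecisive (agentFiber φ i) (Fin.castLE hmm a) (Fin.castLE hmm b)]
      ⟨Or.inl (hΓ hlift.mem_gsFacts), Or.inr rfl⟩)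
    refine (e.trans (h₃ (b := 8) _ (neg (restrictSubst hmm φ (opposed {i} a b, a))) ?_
      (Or.inr rfl) hA8)).le (by omega)
    refine List.mem_map.2 ⟨neg (var (opposed {i} a b, a)), ?_, rfl⟩
    simp only [List.mem_flatMap, List.mem_map, List.mem_filter]
    refine ⟨opposed {i} a b, by simp [gsProfiles], a, ⟨by simp, ?_⟩, rfl⟩
    simpa [opposed, IsTopObject] using topTwo_fst_le a b
  · obtain ⟨o, -, rfl⟩ := List.mem_map.1 hA
    rw [subst_bigDisj] at hA8 ⊢
    -- Surjectivity is witnessed by a unanimous profile; `topTwo o o` is merely some ranking with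
    -- `o` on top.
    refine (h₃ (b := 8) _ (restrictSubst hmm φ (fun _ => topTwo o o, o)) ?_
      (hΓ (unanimity_mem_gsFacts fun j => isTopObject_extendRanking hmm _ (topTwo_fst_le o o)))
      hA8).le (by omega)
    exact List.mem_map.2 ⟨_, List.mem_map.2 ⟨fun _ => topTwo o o, by simp [gsProfiles], rfl⟩, rfl⟩
  · simp only [gsStrategyproof, List.mem_flatMap, List.mem_map] at hA
    obtain ⟨R, -, o, -, i, -, π, -, rfl⟩ := hA
    rw [subst_bigDisj] at hA8 ⊢
    refine (h₁ (l := k₅ + k₆ + (k₂ + 16) + 1) hn hm hnn hmm φ (Function.update R i π) _ hΓ hA8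
      fun o' => ?_).le (by omega)
    by_cases ho : (R i).symm o ≤ (R i).symm o'
    · have e := h₆ (Γ := Γ) (w := gsWeight n m)
        ![(extendProfile hmm φ (Function.update R i π), Fin.castLE hmm o')] trivial
      refine (e.trans (h₂ (b := 8) _ _ (restrictSubst hmm φ (Function.update R i π, o')) ?_
        (Or.inr rfl) hA8 h1)).le (by omega)
      refine List.mem_map.2 ⟨var (Function.update R i π, o'), List.mem_cons_of_mem _
        (List.mem_map.2 ⟨o', ?_, rfl⟩), rfl⟩
      simpa using ho
    · rw [not_le] at ho
      have hne : o' ≠ o := by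
        rintro rfl
        exact ho.ne rfl
      -- Suppose `o` wins before and the better `o'` after the misreport. Both wins lift to `Q`,
      -- where the fiber ranks `o'`, `o` on top and the others are unchanged. This contradicts
      -- uniqueness of the outcome at `Q`.
      set Q : GSProfile n m := fun j => if φ j = i then
        topTwo (Fin.castLE hmm o') (Fin.castLE hmm o) else extendProfile hmm φ R j with hQ
      have hl₁ : Lifts (Fin.castLE hmm o') (extendProfile hmm φ (Function.update R i π)) Q := by
        intro j
        rw [extendProfile_update, hQ]
        dsimp only
        split_ifs
        · exact LiftsAt.of_top _ _ _
        · exact LiftsAt.refl _ _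
      have hl₂ : Lifts (Fin.castLE hmm o) (extendProfile hmm φ R) Q := by
        intro j
        rw [hQ]
        dsimp only
        split_ifs with hj
        · refine LiftsAt.of_lt ((extendRanking_lt_iff hmm _ o' o).2 ?_)
          rwa [hj]
        · exact LiftsAt.refl _ _
      have hinc := incompatible_mem_gsFacts Q (o := Fin.castLE hmm o') (o' := Fin.castLE hmm o)
        (by simpa using hne)
      have e := h₅ (w := gsWeight n m) ![(extendProfile hmm φ (Function.update R i π), Fin.castLE hmm o'),
        (Q, Fin.castLE hmm o'), (extendProfile hmm φ R, Fin.castLE hmm o), (Q, Fin.castLE hmm o)]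
        ⟨hΓ hl₁.mem_gsFacts, hΓ hl₂.mem_gsFacts, hΓ hinc⟩
      refine (e.trans (h₂ (b := 8) _ _ (neg (restrictSubst hmm φ (R, o))) ?_
        (Or.inr rfl) hA8 h1)).le (by omega)
      exact List.mem_map.2 ⟨neg (var (R, o)), List.mem_cons_self, rfl⟩

open PropForm PolyDer

/-! ### Soundness of the data reduction steps -/

theorem StepFregeSound.of_polyDer {V W : Type} {R r a k l w N : ℕ} {Φ : List (PropForm V)}
    {Ψ : List (PropForm W)} (hw : 2 ≤ w) (hr : r ≤ R) (Ξ : Fin r → PropForm V)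
    (s : Fin r → W → PropForm V) (hΞ : PolyDer w k ∅ {bigDisj (List.ofFn Ξ)})
    (hΨ : Ψ.length ≤ w ^ a)
    (h : ∀ t, ∀ B ∈ Ψ, PolyDer w l ({A | A ∈ Φ} ∪ {Ξ t}) {B.subst (s t)})
    (hN : w ^ k + r * w ^ (a + l) ≤ N) : StepFregeSound R Φ Ψ N := by
  obtain ⟨P, hP, hm, hsP⟩ := hΞ hw
  choose Q hQ hmQ hsQ using fun t => of_list Ψ hΨ _ (h t) hw
  refine ⟨r, hr, Ξ, s, P, Q, ⟨hP, hm _ rfl⟩, fun t => ⟨hQ t, fun B hB => hmQ t _ ⟨B, hB, rfl⟩⟩, ?_⟩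
  have : ∑ t, totalSize (Q t) ≤ r * w ^ (a + l) := by
    simpa using Finset.sum_le_card_nsmul Finset.univ (fun t => totalSize (Q t)) _ fun t _ => hsQ t
  omega

theorem pow_add_two_mul_pow_le {w : ℕ} (hw : 2 ≤ w) {r : ℕ} (hr : r ≤ 2) (k l : ℕ) :
    w ^ k + r * w ^ l ≤ w ^ (k + l + 2) := by
  have h₁ := Nat.pow_add_pow_le_pow hw k (l + 1)
  have h₂ : r * w ^ l ≤ w ^ (l + 1) := by
    rw [pow_succ, mul_comm]
    exact Nat.mul_le_mul_left _ (hr.trans hw)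
  have h₃ : k + (l + 1) + 1 = k + l + 2 := by omega
  rw [h₃] at h₁
  omega

/-- Chains may contain steps on which the rule acts as the identity. These use one tautological case
and the identity substitution. -/
theorem stepFregeSound_refl : ∃ k, ∀ {n m : ℕ}, 1 ≤ n → 3 ≤ m →
    StepFregeSound 2 (gsFormula n m) (gsFormula n m) (gsWeight n m ^ k) := by
  obtain ⟨k, hk⟩ := schema (n := 0) [] (.disj (.imp .bot .bot) .bot) (by simp [eval])
  refine ⟨k + 0 + (7 + 8) + 2, fun {n m} hn hm => ?_⟩
  have hw := two_le_gsWeight hn hm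
  refine StepFregeSound.of_polyDer hw one_le_two (fun _ => .imp .bot .bot) (fun _ => var)
    (by simpa [bigDisj, subst] using hk (b := 0) ![] (by simp) (by simp)) (length_gsFormula_le hn hm)
    (l := 8) (fun t B hB => ?_) (pow_add_two_mul_pow_le hw one_le_two _ _)
  rw [subst_var]
  exact hyp (Or.inl hB) (size_le_of_mem_gsFormula hn hm hB)

/-- With `φ = id` the fibers are single agents, which are never decisive, so a single case suffices.
-/
theorem stepFregeSound_restrictObjects : ∃ k, ∀ {n m : ℕ}, 1 ≤ n → 3 ≤ m →
    StepFregeSound 2 (gsFormula n m) (gsFormula n 3) (gsWeight n m ^ k) := by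
  obtain ⟨k₁, h₁⟩ := schema (n := 0) [] (.disj (.imp .bot .bot) .bot) (by simp [eval])
  obtain ⟨k₂, h₂⟩ := polyDer_of_gsFacts
  obtain ⟨k₃, h₃⟩ := polyDer_restrict
  obtain ⟨k₄, h₄⟩ := polyDer_singleton_not_decisive
  refine ⟨k₁ + 0 + (7 + (k₂ + (k₃ + k₄))) + 2, fun {n m} hn hm => ?_⟩
  have hw := two_le_gsWeight hn hm
  refine StepFregeSound.of_polyDer hw one_le_two (fun _ => .imp .bot .bot)
    (fun _ => restrictSubst hm id)
    (by simpa [bigDisj, subst] using h₁ (b := 0) ![] (by simp) (by simp))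
    ((length_gsFormula_le hn le_rfl).trans (Nat.pow_le_pow_left (gsWeight_mono le_rfl hm) 7))
    (fun t B hB => ?_) (pow_add_two_mul_pow_le hw one_le_two _ _)
  refine h₂ hn hm (fun _ => Or.inl) (h₃ hn le_rfl le_rfl hm id (fun _ => Or.inr)
    (a := 0) (b := 1) (by simp) (fun i => ?_) B hB)
  have : agentFiber id i = {i} := by
    ext j
    simp [agentFiber]
  rw [this]
  exact (h₄ hn hm i (by simp)).monoLeft fun _ => Or.inr

/-- The map that merges the agents `p` and `p + 1`. -/
def mergeAgents {n : ℕ} (p : ℕ) (hp : p + 1 < n) (j : Fin n) : Fin (n - 1) :=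
  ⟨if j.val ≤ p then j.val else j.val - 1, by split_ifs <;> omega⟩

theorem agentFiber_mergeAgents {n p : ℕ} (hp : p + 1 < n) (i : Fin (n - 1)) :
    (∃ j, agentFiber (mergeAgents p hp) i = {j}) ∨
      agentFiber (mergeAgents p hp) i = {⟨p, by omega⟩, ⟨p + 1, hp⟩} := by
  have hi := i.isLt
  rcases lt_trichotomy i.val p with h | h | h
  · refine Or.inl ⟨⟨i.val, by omega⟩, ?_⟩
    ext j
    simp only [agentFiber, mergeAgents, Finset.mem_filter, Finset.mem_univ, true_and,
      Finset.mem_singleton, Fin.ext_iff]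
    split_ifs <;> omega
  · refine Or.inr ?_
    ext j
    simp only [agentFiber, mergeAgents, Finset.mem_filter, Finset.mem_univ, true_and,
      Finset.mem_singleton, Finset.mem_insert, Fin.ext_iff]
    split_ifs <;> omega
  · refine Or.inl ⟨⟨i.val + 1, by omega⟩, ?_⟩
    ext j
    simp only [agentFiber, mergeAgents, Finset.mem_filter, Finset.mem_univ, true_and,
      Finset.mem_singleton, Fin.ext_iff]
    split_ifs <;> omega

/-- The coalitions `{0, 1}` and `{1, 2}` are not both decisive, because their intersection `{1}` is
not. If `{0, 1}` is decisive, agents 1 and 2 are merged; otherwise agents 0 and 1 are. -/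
theorem stepFregeSound_removeAgent : ∃ k, ∀ {n m : ℕ}, 3 ≤ n → 3 ≤ m →
    StepFregeSound 2 (gsFormula n m) (gsFormula (n - 1) m) (gsWeight n m ^ k) := by
  obtain ⟨k₁, h₁⟩ := schema_var (n := 1) [] (.disj (.var 0) (.disj (.neg (.var 0)) .bot))
    (by simp [eval]; tauto)
  obtain ⟨k₂, h₂⟩ := polyDer_of_gsFacts
  obtain ⟨k₃, h₃⟩ := polyDer_restrict
  obtain ⟨k₄, h₄⟩ := polyDer_singleton_not_decisive
  obtain ⟨k₅, h₅⟩ := schema_var (n := 1) [.neg (.var 0)] (.imp (.var 0) .bot) (by simp [eval])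
  obtain ⟨k₆, h₆⟩ := polyDer_decisive_inter
  obtain ⟨k₇, h₇⟩ := polyDer_decisive_neutral
  obtain ⟨k₈, h₈⟩ := schema_var (n := 4) [.var 0, .imp (.var 1) (.var 2),
    .imp (.var 0) (.imp (.var 2) (.var 3)), .imp (.var 3) .bot] (.imp (.var 1) .bot)
    (by simp [eval]; tauto)
  refine ⟨k₁ + (7 + (k₂ + (k₃ + (k₄ + k₅ + k₆ + k₇ + k₈ + 10)))) + 2, fun {n m} hn hm => ?_⟩
  have hn1 : 1 ≤ n := by omega
  have hw := two_le_gsWeight hn1 hm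
  let o₀ : Fin m := ⟨0, by omega⟩
  let o₁ : Fin m := ⟨1, by omega⟩
  let o₂ : Fin m := ⟨2, by omega⟩
  have h01 : o₀ ≠ o₁ := by simp [o₀, o₁]
  have h02 : o₀ ≠ o₂ := by simp [o₀, o₂]
  have h12 : o₁ ≠ o₂ := by simp [o₂, o₁]
  let i₁ : Fin n := ⟨1, by omega⟩
  let S : Finset (Fin n) := {⟨0, by omega⟩, i₁}
  let T : Finset (Fin n) := {i₁, ⟨2, by omega⟩}
  have hST : S ∩ T = {i₁} := by
    ext j
    simp only [S, T, i₁, Finset.mem_inter, Finset.mem_insert, Finset.mem_singleton, Fin.ext_iff]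
    omega
  refine StepFregeSound.of_polyDer hw le_rfl
    ![var (gsDecisive S o₀ o₁), neg (var (gsDecisive S o₀ o₁))]
    ![restrictSubst le_rfl (mergeAgents 1 (by omega)),
      restrictSubst le_rfl (mergeAgents 0 (by omega))]
    (by simpa [bigDisj, subst] using h₁ ![gsDecisive S o₀ o₁] trivial)
    ((length_gsFormula_le (by omega) hm).trans (Nat.pow_le_pow_left (gsWeight_mono (by omega)
      le_rfl) 7)) ?_ (pow_add_two_mul_pow_le hw le_rfl _ _)
  rw [Fin.forall_fin_two]
  constructor
  · intro B hB
    refine h₂ hn1 hm (fun _ => Or.inl) (h₃ (by omega) hm (by omega) le_rfl _ (fun _ => Or.inr)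
      h01 (fun i => ?_) B hB)
    simp only [Fin.castLE_rfl, id]
    rcases agentFiber_mergeAgents (p := 1) (n := n) (by omega) i with ⟨j, hj⟩ | hj
    · rw [hj]
      exact ((h₄ hn1 hm j h01).monoLeft fun _ => Or.inr).le (by omega)
    · rw [hj]
      -- Were `T` decisive for `(o₀, o₁)`, neutrality would move it to `(o₁, o₂)`, and with `S`
      -- decisive for `(o₀, o₁)` the singleton `S ∩ T` would be decisive for `(o₀, o₂)`.
      have e₁ := h₇ hn1 hm T h01 h12
      have e₂ := h₆ hn1 hm S T h01 h02 h12
      rw [hST] at e₂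
      have e₃ := h₄ hn1 hm i₁ h02
      have e := ((e₁.union e₂).union e₃).monoLeft (Set.subset_union_right
        (s := {A | A ∈ gsFormula n m} ∪ {var (gsDecisive S o₀ o₁)}))
      exact (e.trans (h₈ ![gsDecisive S o₀ o₁, gsDecisive T o₀ o₁, gsDecisive T o₁ o₂,
        gsDecisive {i₁} o₀ o₂] ⟨Or.inl (Or.inl (Or.inr rfl)), Or.inr (Or.inl (Or.inl rfl)),
          Or.inr (Or.inl (Or.inr rfl)), Or.inr (Or.inr rfl)⟩)).le (by omega)
  · intro B hB
    refine h₂ hn1 hm (fun _ => Or.inl) (h₃ (by omega) hm (by omega) le_rfl _ (fun _ => Or.inr)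
      h01 (fun i => ?_) B hB)
    simp only [Fin.castLE_rfl, id]
    rcases agentFiber_mergeAgents (p := 0) (n := n) (by omega) i with ⟨j, hj⟩ | hj
    · rw [hj]
      exact ((h₄ hn1 hm j h01).monoLeft fun _ => Or.inr).le (by omega)
    · rw [hj]
      -- The two-element fiber is `S` itself, which is not decisive by the hypothesis of this case.
      have hΞ : neg (var (gsDecisive S o₀ o₁)) ∈ {A | A ∈ gsFormula n m} ∪
        {neg (var (gsDecisive S o₀ o₁))} ∪ gsFacts n m := Or.inl (Or.inr rfl)
      exact (h₅ ![gsDecisive S o₀ o₁] hΞ).le (by omega)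

/-- The clauses of `GS_{n,m}` have Frege refutations of polynomial size. -/
theorem exists_isFregeRefutation_gsFormula : ∃ k, ∀ {n m : ℕ}, 1 ≤ n → 3 ≤ m →
    ∃ P, IsFregeRefutation (gsFormula n m) P ∧ totalSize P ≤ totalSize (gsFormula n m) ^ k := by
  obtain ⟨k₁, h₁⟩ := polyDer_of_gsFacts
  obtain ⟨k₂, h₂⟩ := polyDer_bot
  refine ⟨k₁ + k₂, fun {n m} hn hm => ?_⟩
  obtain ⟨P, hP, hm', hs⟩ := h₁ hn hm (Γ := gsClauses n m) le_rfl
    ((h₂ hn hm).monoLeft fun _ => Or.inr) (two_le_gsWeight hn hm)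
  exact ⟨P, ⟨hP, hm' _ rfl⟩, hs.trans (Nat.pow_le_pow_left (gsWeight_le_totalSize n m) _)⟩

/-- The Gibbard–Satterthwaite theorem. -/
theorem mem_gsProblem {n m : ℕ} : (n, m) ∈ gsProblem ↔ 1 ≤ n ∧ 3 ≤ m := by
  refine ⟨fun h => ⟨h.1, h.2.1⟩, fun h => ⟨h.1, h.2, ?_⟩⟩
  obtain ⟨k, hk⟩ := exists_isFregeRefutation_gsFormula
  obtain ⟨P, hP, -⟩ := hk h.1 h.2
  exact hP.unsat

/-! ### Turing machines for the data reduction rules -/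

/-- The number `k`, capped at three. -/
def capThree (k : ℕ) : Fin 4 := ⟨min k 3, by omega⟩

theorem capThree_succ (k : ℕ) : capThree ((capThree k).val + 1) = capThree (k + 1) := by
  ext
  simp only [capThree]
  omega

/-- The memory of the machine: the capped numbers of agents and objects in the input, and the
capped numbers of agents and objects that have been processed in the second phase. -/
abbrev SweepState : Type := (Fin 4 × Fin 4) × Fin 4 × Fin 4

/-- Update of the memory in the first phase. -/
def sweepCount (s : SweepState) : Bool ⊕ Bool → SweepState
  | .inl _ => ((capThree (s.1.1.val + 1), s.1.2), s.2)
  | .inr _ => ((s.1.1, capThree (s.1.2.val + 1)), s.2)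

/-- Update of the memory in the second phase. -/
def sweepProcess (s : SweepState) : Bool ⊕ Bool → SweepState
  | .inl _ => (s.1, capThree (s.2.1.val + 1), s.2.2)
  | .inr _ => (s.1, s.2.1, capThree (s.2.2.val + 1))

/-- The decision whether a symbol is kept. -/
def sweepKeep (keepL keepR : Fin 4 × Fin 4 → Fin 4 → Bool) (s : SweepState) : Bool ⊕ Bool → Bool
  | .inl _ => keepL s.1 s.2.1
  | .inr _ => keepR s.1 s.2.2

open Turing TM2.Stmt in
/-- The machine that first moves its input to an auxiliary stack, counting the agents and the
objects up to three, and then moves it back, dropping some symbols on the way. -/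
def sweepMachine (keepL keepR : Fin 4 × Fin 4 → Fin 4 → Bool) : FinTM2 where
  K := Bool
  k₀ := false
  k₁ := false
  Γ _ := Bool ⊕ Bool
  Λ := Bool
  main := false
  σ := SweepState × Option (Bool ⊕ Bool)
  initialState := (((0, 0), 0, 0), none)
  Γk₀Fin := inferInstanceAs (Fintype (Bool ⊕ Bool))
  m
  -- The default `.inl true` is never used, as the branch has checked that a symbol was read.
  | false => pop false (fun v x => (v.1, x)) <| branch (fun v => v.2.isSome)
      (push true (fun v => v.2.getD (.inl true)) <|
        load (fun v => (sweepCount v.1 (v.2.getD (.inl true)), none)) <| goto fun _ => false)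
      (goto fun _ => true)
  | true => pop true (fun v x => (v.1, x)) <| branch (fun v => v.2.isSome)
      (branch (fun v => sweepKeep keepL keepR v.1 (v.2.getD (.inl true)))
        (push false (fun v => v.2.getD (.inl true)) <|
          load (fun v => (sweepProcess v.1 (v.2.getD (.inl true)), none)) <| goto fun _ => true)
        (load (fun v => (sweepProcess v.1 (v.2.getD (.inl true)), none)) <| goto fun _ => true))
      -- The memory is reset because a halting configuration must carry the initial state.
      (load (fun _ => (((0, 0), 0, 0), none)) halt)

section

variable (keepL keepR : Fin 4 × Fin 4 → Fin 4 → Bool)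

/-- A configuration of the machine with main stack `A` and auxiliary stack `B`. -/
def sweepCfg (l : Option Bool) (s : SweepState) (A B : List (Bool ⊕ Bool)) :
    (sweepMachine keepL keepR).Cfg :=
  (⟨l, (s, none), fun k => cond k B A⟩ : Turing.TM2.Cfg (fun _ : Bool => Bool ⊕ Bool) Bool _)

/-- The main stack after the second phase. -/
def sweepBack : SweepState → List (Bool ⊕ Bool) → List (Bool ⊕ Bool) → List (Bool ⊕ Bool)
  | _, [], A => A
  | s, x :: B, A =>
    sweepBack (sweepProcess s x) B (if sweepKeep keepL keepR s x then x :: A else A)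

theorem step_sweepCfg_false_cons (s : SweepState) (x : Bool ⊕ Bool) (A B : List (Bool ⊕ Bool)) :
    (sweepMachine keepL keepR).step (sweepCfg keepL keepR (some false) s (x :: A) B) =
      some (sweepCfg keepL keepR (some false) (sweepCount s x) A (x :: B)) := by
  simp only [Turing.FinTM2.step, sweepCfg, sweepMachine, Turing.TM2.step, Turing.TM2.stepAux,
    cond_false, cond_true, List.head?_cons, Option.isSome_some, Option.getD_some]
  congr 2
  funext k
  cases k <;> simp [Function.update]

theorem step_sweepCfg_false_nil (s : SweepState) (B : List (Bool ⊕ Bool)) :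
    (sweepMachine keepL keepR).step (sweepCfg keepL keepR (some false) s [] B) =
      some (sweepCfg keepL keepR (some true) s [] B) := by
  simp only [Turing.FinTM2.step, sweepCfg, sweepMachine, Turing.TM2.step, Turing.TM2.stepAux,
    cond_false, List.head?_nil, Option.isSome_none]
  congr 2
  funext k
  cases k <;> simp [Function.update]

theorem step_sweepCfg_true_cons (s : SweepState) (x : Bool ⊕ Bool) (A B : List (Bool ⊕ Bool)) :
    (sweepMachine keepL keepR).step (sweepCfg keepL keepR (some true) s A (x :: B)) =
      some (sweepCfg keepL keepR (some true) (sweepProcess s x)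
        (if sweepKeep keepL keepR s x then x :: A else A) B) := by
  simp only [Turing.FinTM2.step, sweepCfg, sweepMachine, Turing.TM2.step, Turing.TM2.stepAux]
  by_cases h : sweepKeep keepL keepR s x
  all_goals
    simp only [List.head?_cons, Option.isSome_some, Option.getD_some, cond_true, cond_false, h,
      if_true]
    congr 2
    funext k
    cases k <;> simp [Function.update]

theorem step_sweepCfg_true_nil (s : SweepState) (A : List (Bool ⊕ Bool)) :
    (sweepMachine keepL keepR).step (sweepCfg keepL keepR (some true) s A []) =
      some (sweepCfg keepL keepR none ((0, 0), 0, 0) A []) := by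
  simp only [Turing.FinTM2.step, sweepCfg, sweepMachine, Turing.TM2.step, Turing.TM2.stepAux,
    cond_false, cond_true, List.head?_nil, Option.isSome_none]
  congr 2
  funext k
  cases k <;> simp [Function.update]

-- One step per symbol and one more to change the phase; the auxiliary stack receives the input in
-- reverse.
open StateTransition in
theorem nonempty_evalsToInTime_count (A : List (Bool ⊕ Bool)) :
    ∀ (s : SweepState) (B : List (Bool ⊕ Bool)),
      Nonempty (EvalsToInTime (sweepMachine keepL keepR).step
        (sweepCfg keepL keepR (some false) s A B)
        (some (sweepCfg keepL keepR (some true) (A.foldl sweepCount s) [] (A.reverse ++ B)))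
        (A.length + 1)) := by
  induction A with
  | nil => exact fun s B => ⟨⟨⟨1, step_sweepCfg_false_nil keepL keepR s B⟩, le_rfl⟩⟩
  | cons x A ih =>
    intro s B
    obtain ⟨h⟩ := ih (sweepCount s x) (x :: B)
    have h₁ : EvalsToInTime (sweepMachine keepL keepR).step
      (sweepCfg keepL keepR (some false) s (x :: A) B)
      (some (sweepCfg keepL keepR (some false) (sweepCount s x) A (x :: B))) 1 :=
      ⟨⟨1, step_sweepCfg_false_cons keepL keepR s x A B⟩, le_rfl⟩
    simpa using (⟨EvalsToInTime.trans _ _ _ _ _ _ h₁ h⟩ : Nonempty _)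

open StateTransition in
theorem nonempty_evalsToInTime_back (B : List (Bool ⊕ Bool)) :
    ∀ (s : SweepState) (A : List (Bool ⊕ Bool)),
      Nonempty (EvalsToInTime (sweepMachine keepL keepR).step
        (sweepCfg keepL keepR (some true) s A B)
        (some (sweepCfg keepL keepR none ((0, 0), 0, 0) (sweepBack keepL keepR s B A) []))
        (B.length + 1)) := by
  induction B with
  | nil => exact fun s A => ⟨⟨⟨1, step_sweepCfg_true_nil keepL keepR s A⟩, le_rfl⟩⟩
  | cons x B ih =>
    intro s A
    obtain ⟨h⟩ := ih (sweepProcess s x) (if sweepKeep keepL keepR s x then x :: A else A)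
    have h₁ : EvalsToInTime (sweepMachine keepL keepR).step
      (sweepCfg keepL keepR (some true) s A (x :: B)) _ 1 :=
      ⟨⟨1, step_sweepCfg_true_cons keepL keepR s x A B⟩, le_rfl⟩
    exact ⟨EvalsToInTime.trans _ _ _ _ _ _ h₁ h⟩

open Turing StateTransition in
/-- The machine computes its output in linear time. -/
theorem nonempty_outputs_sweepMachine (A B A' : List (Bool ⊕ Bool)) (hA : A' = A)
    (hB : B = sweepBack keepL keepR (A.foldl sweepCount ((0, 0), 0, 0)) A.reverse []) :
    Nonempty (TM2OutputsInTime (sweepMachine keepL keepR) A' (some B)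
      (A.length + 1 + (A.length + 1))) := by
  subst hA hB
  obtain ⟨h₁⟩ := nonempty_evalsToInTime_count keepL keepR A' ((0, 0), 0, 0) []
  obtain ⟨h₂⟩ := nonempty_evalsToInTime_back keepL keepR (A'.reverse ++ [])
    (A'.foldl sweepCount ((0, 0), 0, 0)) []
  have h := EvalsToInTime.trans _ _ _ _ _ _ h₁ h₂
  have e₁ : initList (sweepMachine keepL keepR) A' =
      sweepCfg keepL keepR (some false) ((0, 0), 0, 0) A' [] := by
    simp only [initList, sweepCfg]
    congr 1
    funext k
    cases k <;> rfl
  have e₂ : ∀ C, haltList (sweepMachine keepL keepR) C =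
      sweepCfg keepL keepR none ((0, 0), 0, 0) C [] := by
    intro C
    simp only [haltList, sweepCfg]
    congr 1
    funext k
    cases k <;> rfl
  unfold TM2OutputsInTime
  rw [e₁]
  refine ⟨⟨⟨h.steps, ?_⟩, by simpa using h.steps_le_m⟩⟩
  refine h.evals_in_steps.trans (congrArg some ?_)
  rw [List.append_nil]
  exact (e₂ _).symm

/-! ### The action of the machine on unary codes -/

theorem foldl_sweepCount_inl (n : ℕ) : ∀ k l : ℕ, ∀ p : Fin 4 × Fin 4,
    (List.replicate n (Sum.inl true)).foldl sweepCount ((capThree k, capThree l), p) =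
      ((capThree (k + n), capThree l), p) := by
  induction n with
  | zero => intros; rfl
  | succ n ih =>
    intro k l p
    rw [List.replicate_succ, List.foldl_cons, sweepCount, capThree_succ, ih, Nat.add_right_comm]
    rfl

theorem foldl_sweepCount_inr (n : ℕ) : ∀ k l : ℕ, ∀ p : Fin 4 × Fin 4,
    (List.replicate n (Sum.inr true)).foldl sweepCount ((capThree k, capThree l), p) =
      ((capThree k, capThree (l + n)), p) := by
  induction n with
  | zero => intros; rfl
  | succ n ih =>
    intro k l p
    rw [List.replicate_succ, List.foldl_cons, sweepCount, capThree_succ, ih, Nat.add_right_comm]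
    rfl

/-- The invariant of the second phase: after `k` agent symbols, the number kept is the number of
indices `j < k` that `keepL` accepts. -/
theorem sweepBack_inl (s : Fin 4 × Fin 4) (q : Fin 4) (B A : List (Bool ⊕ Bool)) (n : ℕ) :
    ∀ k : ℕ, sweepBack keepL keepR (s, capThree k, q) (List.replicate n (Sum.inl true) ++ B)
        (List.replicate (Nat.count (fun j => keepL s (capThree j)) k) (Sum.inl true) ++ A) =
      sweepBack keepL keepR (s, capThree (k + n), q) B
        (List.replicate (Nat.count (fun j => keepL s (capThree j)) (k + n)) (Sum.inl true) ++ A) := by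
  induction n with
  | zero => intros; rfl
  | succ n ih =>
    intro k
    rw [List.replicate_succ, List.cons_append, sweepBack]
    have h := ih (k + 1)
    rw [Nat.count_succ] at h
    simp only [sweepProcess, sweepKeep, capThree_succ]
    rw [show k + (n + 1) = k + 1 + n by omega, ← h]
    by_cases hk : keepL s (capThree k) <;> simp [hk, List.replicate_succ]

theorem sweepBack_inr (s : Fin 4 × Fin 4) (p : Fin 4) (B A : List (Bool ⊕ Bool)) (n : ℕ) :
    ∀ k : ℕ, sweepBack keepL keepR (s, p, capThree k) (List.replicate n (Sum.inr true) ++ B)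
        (List.replicate (Nat.count (fun j => keepR s (capThree j)) k) (Sum.inr true) ++ A) =
      sweepBack keepL keepR (s, p, capThree (k + n)) B
        (List.replicate (Nat.count (fun j => keepR s (capThree j)) (k + n)) (Sum.inr true) ++ A) := by
  induction n with
  | zero => intros; rfl
  | succ n ih =>
    intro k
    rw [List.replicate_succ, List.cons_append, sweepBack]
    have h := ih (k + 1)
    rw [Nat.count_succ] at h
    simp only [sweepProcess, sweepKeep, capThree_succ]
    rw [show k + (n + 1) = k + 1 + n by omega, ← h]
    by_cases hk : keepR s (capThree k) <;> simp [hk, List.replicate_succ]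

theorem unaryEncodeNat_eq_replicate (n : ℕ) :
    Computability.unaryEncodeNat n = List.replicate n true := by
  induction n with
  | zero => rfl
  | succ n ih => rw [Computability.unaryEncodeNat, ih, List.replicate_succ]

theorem gsEncoding_encode (n m : ℕ) : gsEncoding.encode (n, m) =
    List.replicate n (Sum.inl true) ++ List.replicate m (Sum.inr true) := by
  simp [gsEncoding, Computability.encodingProd, Computability.unaryEncodingNat,
    unaryEncodeNat_eq_replicate]

theorem length_gsEncoding (x : ℕ × ℕ) : (gsEncoding.encode x).length = x.1 + x.2 := by
  rw [← Prod.mk.eta (p := x), gsEncoding_encode]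
  simp

/-- The reversed code presents the objects first; pushing the kept symbols restores the order, so
the result is again the code of a pair. -/
theorem sweepBack_gsEncoding (n m : ℕ) :
    sweepBack keepL keepR ((gsEncoding.encode (n, m)).foldl sweepCount ((0, 0), 0, 0))
      (gsEncoding.encode (n, m)).reverse [] = gsEncoding.encode
        (Nat.count (fun k => keepL (capThree n, capThree m) (capThree k)) n,
          Nat.count (fun k => keepR (capThree n, capThree m) (capThree k)) m) := by
  have h₁ := foldl_sweepCount_inl n 0 0 (capThree 0, capThree 0)
  have h₂ := foldl_sweepCount_inr m n 0 (capThree 0, capThree 0)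
  have h₃ := sweepBack_inr keepL keepR (capThree n, capThree m) (capThree 0)
    (List.replicate n (Sum.inl true) ++ []) [] m 0
  have h₄ := sweepBack_inl keepL keepR (capThree n, capThree m) (capThree m) []
    (List.replicate (Nat.count (fun k => keepR (capThree n, capThree m) (capThree k)) m)
      (Sum.inr true)) n 0
  simp only [Nat.zero_add, Nat.count_zero, List.replicate_zero, List.nil_append, List.append_nil,
    sweepBack] at h₁ h₂ h₃ h₄
  rw [gsEncoding_encode, gsEncoding_encode, List.foldl_append, List.reverse_append,
    List.reverse_replicate, List.reverse_replicate]
  exact (congrArg (fun s => sweepBack keepL keepR s _ []) ((congrArg (fun s =>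
    List.foldl sweepCount s (List.replicate m (Sum.inr true))) h₁).trans h₂)).trans
    (h₃.trans h₄)

open Turing Polynomial in
/-- Maps on instances that a machine with two phases computes. -/
theorem nonempty_polyTime_of_count (A : ℕ × ℕ → ℕ × ℕ)
    (h₁ : ∀ n m, (A (n, m)).1 =
      Nat.count (fun k => keepL (capThree n, capThree m) (capThree k)) n)
    (h₂ : ∀ n m, (A (n, m)).2 =
      Nat.count (fun k => keepR (capThree n, capThree m) (capThree k)) m) :
    Nonempty (TM2ComputableInPolyTime gsEncoding.encode gsEncoding.encode A) := by
  refine ⟨{ tm := sweepMachine keepL keepR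
            inputAlphabet := Equiv.refl _
            outputAlphabet := Equiv.refl _
            time := X + 1 + (X + 1)
            outputsFun := fun x => Classical.choice ?_ }⟩
  obtain ⟨n, m⟩ := x
  have hout := sweepBack_gsEncoding keepL keepR n m
  rw [← h₁, ← h₂] at hout
  have h := nonempty_outputs_sweepMachine keepL keepR (gsEncoding.encode (n, m)) _ _
    (List.map_id _) ((List.map_id _).trans hout.symm)
  have ht : (X + 1 + (X + 1) : ℕ[X]).eval (gsEncoding.encode (n, m)).length =
      (gsEncoding.encode (n, m)).length + 1 + ((gsEncoding.encode (n, m)).length + 1) := by simp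
  rw [← ht] at h
  exact h

end

/-! ### The three maps as counting machines -/

theorem count_capThree_lt {c : ℕ} (hc : c ≤ 3) (n : ℕ) :
    Nat.count (fun k => decide ((capThree k).val < c) = true) n = min n c := by
  induction n with
  | zero => simp
  | succ n ih =>
    rw [Nat.count_succ, ih]
    by_cases h : (capThree n).val < c
    · rw [if_pos (decide_eq_true h)]
      simp only [capThree] at h
      omega
    · rw [if_neg (by simpa using h)]
      simp only [capThree] at h
      omega

theorem count_capThree_ne_zero (n : ℕ) :
    Nat.count (fun k => decide ((capThree k).val ≠ 0) = true) n = n - 1 := by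
  induction n with
  | zero => simp
  | succ n ih =>
    rw [Nat.count_succ, ih]
    by_cases h : (capThree n).val ≠ 0
    · rw [if_pos (decide_eq_true h)]
      simp only [capThree] at h
      omega
    · rw [if_neg (by simpa using h)]
      simp only [capThree] at h
      omega

theorem three_le_capThree {n : ℕ} : 3 ≤ (capThree n).val ↔ 3 ≤ n := by
  simp only [capThree]
  omega

theorem nonempty_polyTime_gsRestrictObjects : Nonempty (Turing.TM2ComputableInPolyTime
    gsEncoding.encode gsEncoding.encode gsRestrictObjects) := by
  -- Keeping the first three object symbols changes nothing when there are at most three, so the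
  -- machine need not test `4 ≤ m`.
  refine nonempty_polyTime_of_count (fun _ _ => true) (fun _ q => decide (q.val < 3)) _ ?_ ?_
  · intro n m
    unfold gsRestrictObjects
    split_ifs <;> simp
  · intro n m
    rw [count_capThree_lt le_rfl]
    unfold gsRestrictObjects
    split_ifs with h <;> simp only at h ⊢ <;> omega

theorem nonempty_polyTime_gsRemoveAgent : Nonempty (Turing.TM2ComputableInPolyTime
    gsEncoding.encode gsEncoding.encode gsRemoveAgent) := by
  refine nonempty_polyTime_of_count
    (fun s q => if 3 ≤ s.1.val ∧ 3 ≤ s.2.val then decide (q.val ≠ 0) else true)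
    (fun _ _ => true) _ ?_ ?_
  · intro n m
    simp only [three_le_capThree, gsRemoveAgent]
    split_ifs
    · exact (count_capThree_ne_zero n).symm
    · simp
  · intro n m
    unfold gsRemoveAgent
    split_ifs <;> simp

theorem nonempty_polyTime_gsKernel : Nonempty (Turing.TM2ComputableInPolyTime
    gsEncoding.encode gsEncoding.encode gsKernel) := by
  refine nonempty_polyTime_of_count
    (fun s q => if 3 ≤ s.2.val then decide (q.val < 2) else true)
    (fun s q => if 3 ≤ s.2.val then decide (q.val < 3) else true) _ ?_ ?_
  all_goals
    intro n m
    simp only [three_le_capThree, gsKernel]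
    split_ifs with h
  · exact (count_capThree_lt (by omega) n).symm
  · simp
  · rw [count_capThree_lt le_rfl]
    simp only at h ⊢
    omega
  · simp

/-! ### Data reduction, kernelization and chains -/

theorem forall_gsRules {p : (ℕ × ℕ → ℕ × ℕ) → Prop} :
    (∀ A ∈ gsRules, p A) ↔ p gsRestrictObjects ∧ p gsRemoveAgent := by
  simp [gsRules]

theorem isDataReductionRule_gsRestrictObjects :
    IsDataReductionRule gsEncoding gsProblem gsRestrictObjects where
  polyTime := nonempty_polyTime_gsRestrictObjects
  safe := fun ⟨n, m⟩ => by
    unfold gsRestrictObjects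
    split_ifs with h
    · simp only at h ⊢
      rw [mem_gsProblem, mem_gsProblem]
      omega
    · rfl
  length_le := fun ⟨n, m⟩ => by
    rw [length_gsEncoding, length_gsEncoding]
    unfold gsRestrictObjects
    split_ifs with h
    · simp only at h ⊢
      omega
    · rfl

theorem isDataReductionRule_gsRemoveAgent :
    IsDataReductionRule gsEncoding gsProblem gsRemoveAgent where
  polyTime := nonempty_polyTime_gsRemoveAgent
  safe := fun ⟨n, m⟩ => by
    unfold gsRemoveAgent
    split_ifs with h
    · simp only at h ⊢
      rw [mem_gsProblem, mem_gsProblem]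
      omega
    · rfl
  length_le := fun ⟨n, m⟩ => by
    rw [length_gsEncoding, length_gsEncoding]
    unfold gsRemoveAgent
    split_ifs with h
    · simp only at h ⊢
      omega
    · rfl

theorem isKernelization_gsKernel : IsKernelization gsEncoding Prod.fst gsProblem gsKernel where
  polyTime := nonempty_polyTime_gsKernel
  safe := fun ⟨n, m⟩ => by
    unfold gsKernel
    split_ifs with h
    · simp only at h ⊢
      rw [mem_gsProblem, mem_gsProblem]
      omega
    · rfl
  bounded := by
    -- The value has length at most `2 + 3` if `m ≥ 3`, and otherwise `n + m ≤ n + 2`.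
    refine ⟨fun k => k + 5, (Primrec.nat_add.comp .id (.const 5)).to_comp, fun ⟨n, m⟩ => ?_⟩
    rw [length_gsEncoding]
    unfold gsKernel
    split_ifs with h <;> simp only at h ⊢ <;> omega

section

variable {n m l : ℕ} {c : Fin (l + 1) → ℕ × ℕ}

/-- Both rules preserve the value of the kernel map, which makes the end of a chain unique. The
upper bounds let the weight of the initial instance control every step. -/
theorem IsReductionChain.invariant (hn : 1 ≤ n) (hm : 3 ≤ m)
    (h : IsReductionChain gsRules (n, m) l c) (i : Fin (l + 1)) :
    (1 ≤ (c i).1 ∧ (c i).1 ≤ n) ∧ (3 ≤ (c i).2 ∧ (c i).2 ≤ m) ∧ gsKernel (c i) = gsKernel (n, m) := by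
  induction i using Fin.induction with
  | zero =>
    rw [h.1]
    exact ⟨⟨hn, le_rfl⟩, ⟨hm, le_rfl⟩, rfl⟩
  | succ i ih =>
    obtain ⟨A, hA, hstep⟩ := h.2.1 i
    have key : ∀ A ∈ gsRules, (1 ≤ (A (c i.castSucc)).1 ∧ (A (c i.castSucc)).1 ≤ n) ∧
        (3 ≤ (A (c i.castSucc)).2 ∧ (A (c i.castSucc)).2 ≤ m) ∧
          gsKernel (A (c i.castSucc)) = gsKernel (c i.castSucc) := by
      obtain ⟨⟨h₁, h₂⟩, ⟨h₃, h₄⟩, -⟩ := ih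
      generalize c i.castSucc = x at *
      rw [forall_gsRules]
      constructor
      · unfold gsRestrictObjects
        split_ifs with hx
        · refine ⟨⟨h₁, h₂⟩, ⟨le_rfl, hm⟩, ?_⟩
          simp [gsKernel, h₃]
        · exact ⟨⟨h₁, h₂⟩, ⟨h₃, h₄⟩, rfl⟩
      · unfold gsRemoveAgent
        split_ifs with hx
        · refine ⟨⟨by simp only; omega, by simp only; omega⟩, ⟨h₃, h₄⟩, ?_⟩
          simp only [gsKernel, h₃, if_true, Prod.mk.injEq, and_true]
          omega
        · exact ⟨⟨h₁, h₂⟩, ⟨h₃, h₄⟩, rfl⟩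
    rw [hstep]
    obtain ⟨h₁, h₂, h₃⟩ := key A hA
    exact ⟨h₁, h₂, h₃.trans ih.2.2⟩

theorem IsReductionChain.last_eq (hn : 1 ≤ n) (hm : 3 ≤ m)
    (h : IsReductionChain gsRules (n, m) l c) : c (Fin.last l) = gsKernel (n, m) := by
  obtain ⟨⟨h₁, -⟩, ⟨h₂, -⟩, h₃⟩ := h.invariant hn hm (Fin.last l)
  obtain ⟨hA, hB⟩ := forall_gsRules.1 h.2.2
  rw [← h₃]
  -- An instance fixed by both rules has at most two agents and three objects, so it is its own
  -- kernel.
  generalize c (Fin.last l) = x at *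
  obtain ⟨a, b⟩ := x
  simp only [gsRestrictObjects, gsRemoveAgent, gsKernel] at *
  split_ifs at * <;> simp only [Prod.mk.injEq] at * <;> omega

theorem IsReductionChain.length_le (hn : 1 ≤ n)
    (h : IsReductionChain gsRules (n, m) l c) (hne : ∀ i : Fin l, c i.succ ≠ c i.castSucc) :
    l ≤ 2 * n := by
  -- The number of agents, plus one if there are more than three objects, drops with every changing
  -- step. It starts at `n + 1` at most, so `ℓ ≤ n + 1 ≤ 2 * n`.
  have key : ∀ i : Fin (l + 1), (c i).1 + (if 4 ≤ (c i).2 then 1 else 0) + i.val ≤ n + 1 := by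
    intro i
    induction i using Fin.induction with
    | zero =>
      rw [h.1]
      simp only [Fin.val_zero]
      split_ifs <;> omega
    | succ i ih =>
      obtain ⟨A, hA, hstep⟩ := h.2.1 i
      have hstep' : ∀ A ∈ gsRules, A (c i.castSucc) ≠ c i.castSucc →
          (A (c i.castSucc)).1 + (if 4 ≤ (A (c i.castSucc)).2 then 1 else 0) + 1 ≤
            (c i.castSucc).1 + (if 4 ≤ (c i.castSucc).2 then 1 else 0) := by
        generalize c i.castSucc = x
        rw [forall_gsRules]
        constructor
        · intro hx
          unfold gsRestrictObjects at hx ⊢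
          by_cases h4 : 4 ≤ x.2
          · simp [h4]
          · exact absurd (if_neg h4) hx
        · intro hx
          unfold gsRemoveAgent at hx ⊢
          by_cases h3 : 3 ≤ x.1 ∧ 3 ≤ x.2
          · rw [if_pos h3]
            simp only
            omega
          · exact absurd (if_neg h3) hx
      have := hstep' A hA (hstep ▸ hne i)
      rw [← hstep] at this
      simp only [Fin.val_castSucc, Fin.val_succ] at ih ⊢
      omega
  have := key (Fin.last l)
  simp only [Fin.val_last] at this
  omega

end

theorem exists_isReductionChain {n m : ℕ} (hn : 1 ≤ n) (hm : 3 ≤ m) :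
    ∃ (l : ℕ) (c : Fin (l + 1) → ℕ × ℕ), IsReductionChain gsRules (n, m) l c ∧ l ≤ 2 * n := by
  -- First restrict the objects (the identity if `m = 3`), then remove agents one by one. The
  -- truncated `n - 2` is zero for `n = 1`.
  refine ⟨n - 2 + 1, fun i => if i.val = 0 then (n, m) else (n - (i.val - 1), 3),
    ⟨by simp, fun i => ?_, ?_⟩, by omega⟩
  · rcases Nat.eq_zero_or_pos i.val with hi | hi
    · refine ⟨gsRestrictObjects, by simp [gsRules], ?_⟩
      simp only [Fin.val_succ, Fin.val_castSucc, hi, gsRestrictObjects]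
      split_ifs <;> simp_all
      omega
    · refine ⟨gsRemoveAgent, by simp [gsRules], ?_⟩
      have := i.isLt
      simp only [Fin.val_succ, Fin.val_castSucc, gsRemoveAgent, if_neg hi.ne', le_refl, and_true]
      rw [if_neg (by omega), if_pos (by omega)]
      simp only [Prod.mk.injEq, and_true]
      omega
  · rw [forall_gsRules]
    simp only [Fin.val_last, gsRestrictObjects, gsRemoveAgent]
    constructor
    · simp
    · simp
      omega

/-! ### The main theorem -/

theorem StepFregeSound.mono {V W : Type} {R N N' : ℕ} {Φ : List (PropForm V)}
    {Ψ : List (PropForm W)} (h : StepFregeSound R Φ Ψ N) (hN : N ≤ N') :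
    StepFregeSound R Φ Ψ N' := by
  obtain ⟨r, hr, Ξ, s, P, Q, h₁, h₂, h₃⟩ := h
  exact ⟨r, hr, Ξ, s, P, Q, h₁, h₂, h₃.trans hN⟩

theorem stepFregeSound_gsRules : ∃ k, ∀ {n m : ℕ}, 1 ≤ n → 3 ≤ m → ∀ A ∈ gsRules,
    StepFregeSound 2 (gsFormula n m) (gsFormula (A (n, m)).1 (A (n, m)).2) (gsWeight n m ^ k) := by
  obtain ⟨k₁, h₁⟩ := stepFregeSound_refl
  obtain ⟨k₂, h₂⟩ := stepFregeSound_restrictObjects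
  obtain ⟨k₃, h₃⟩ := stepFregeSound_removeAgent
  refine ⟨k₁ + k₂ + k₃, fun {n m} hn hm => ?_⟩
  have hw := two_le_gsWeight hn hm
  have hpow : ∀ k, k ≤ k₁ + k₂ + k₃ → gsWeight n m ^ k ≤ gsWeight n m ^ (k₁ + k₂ + k₃) :=
    fun k hk => Nat.pow_le_pow_right (by omega) hk
  rw [forall_gsRules]
  constructor
  · by_cases h : 4 ≤ m
    · rw [show gsRestrictObjects (n, m) = (n, 3) from if_pos h]
      exact (h₂ hn hm).mono (hpow _ (by omega))
    · rw [show gsRestrictObjects (n, m) = (n, m) from if_neg h]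
      exact (h₁ hn hm).mono (hpow _ (by omega))
  · by_cases h : 3 ≤ n ∧ 3 ≤ m
    · rw [show gsRemoveAgent (n, m) = (n - 1, m) from if_pos h]
      exact (h₃ h.1 hm).mono (hpow _ (by omega))
    · rw [show gsRemoveAgent (n, m) = (n, m) from if_neg h]
      exact (h₁ hn hm).mono (hpow _ (by omega))

theorem isQuasipolynomial_pow (k : ℕ) : IsQuasipolynomial fun s => s ^ k := by
  -- With this constant the bounding function equals `s ^ k` for `s ≥ 1`.
  refine ⟨1, k / Real.log 2, one_pos, Asymptotics.IsBigO.of_bound 1 ?_⟩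
  filter_upwards [Filter.eventually_ge_atTop 1] with s hs
  have hs' : (0 : ℝ) < s := by exact_mod_cast hs
  have h2 : Real.log 2 ≠ 0 := (Real.log_pos one_lt_two).ne'
  rw [one_mul, pow_one, Real.rpow_def_of_pos two_pos]
  have : Real.log 2 * (k / Real.log 2 * Real.log s) = k * Real.log s := by
    field_simp
  rw [this, ← Real.log_pow, Real.exp_log (by positivity)]
  simp

theorem mainTheorem4 :
    -- the two rules are data reduction rules, and the map to their common kernel is a kernelization
    (∀ A ∈ gsRules, IsDataReductionRule gsEncoding gsProblem A) ∧
    IsKernelization gsEncoding Prod.fst gsProblem gsKernel ∧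
    -- data reduction chains lead to the kernel and have length `O(n)`
    (∃ C : ℕ, ∀ n m : ℕ, 1 ≤ n → 3 ≤ m →
      (∃ (ℓ : ℕ) (c : Fin (ℓ + 1) → ℕ × ℕ), IsReductionChain gsRules (n, m) ℓ c ∧ ℓ ≤ C * n) ∧
      ∀ (ℓ : ℕ) (c : Fin (ℓ + 1) → ℕ × ℕ), IsReductionChain gsRules (n, m) ℓ c →
        c (Fin.last ℓ) = gsKernel (n, m) ∧
        ((∀ i : Fin ℓ, c i.succ ≠ c i.castSucc) → ℓ ≤ C * n)) ∧
    -- the soundness of the steps of the chains has polynomial-size Frege proofs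
    (∃ (R : ℕ) (p : Polynomial ℕ), ∀ n m : ℕ, 1 ≤ n → 3 ≤ m →
      ∀ (ℓ : ℕ) (c : Fin (ℓ + 1) → ℕ × ℕ), IsReductionChain gsRules (n, m) ℓ c →
        ∀ i : Fin ℓ,
          StepFregeSound R (gsFormula (c i.castSucc).1 (c i.castSucc).2)
            (gsFormula (c i.succ).1 (c i.succ).2) (p.eval (totalSize (gsFormula n m)))) ∧
    -- (a) Frege proofs of quasipolynomial size
    (∃ f : ℕ → ℕ, IsQuasipolynomial f ∧ ∀ n m : ℕ, 1 ≤ n → 3 ≤ m →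
      ∃ P : List (PropForm (GSVar n m)), IsFregeRefutation (gsFormula n m) P ∧
        totalSize P ≤ f (totalSize (gsFormula n m))) ∧
    -- (b) for every fixed number of agents, Frege proofs of polynomial size
    (∀ n : ℕ, 1 ≤ n → ∃ p : Polynomial ℕ, ∀ m : ℕ, 3 ≤ m →
      ∃ P : List (PropForm (GSVar n m)), IsFregeRefutation (gsFormula n m) P ∧
        totalSize P ≤ p.eval (totalSize (gsFormula n m))) := by

  -- One exponent works for all `n` and `m`, so this refutation yields both (a) and (b) without
  -- passing through a chain.
  obtain ⟨k, hk⟩ := exists_isFregeRefutation_gsFormula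
  refine ⟨forall_gsRules.2 ⟨isDataReductionRule_gsRestrictObjects,
    isDataReductionRule_gsRemoveAgent⟩, isKernelization_gsKernel, ?_, ?_, ?_, ?_⟩
  · exact ⟨2, fun n m hn hm => ⟨exists_isReductionChain hn hm, fun l c h =>
      ⟨h.last_eq hn hm, h.length_le hn⟩⟩⟩
  · obtain ⟨k₂, h₂⟩ := stepFregeSound_gsRules
    refine ⟨2, Polynomial.X ^ k₂, fun n m hn hm l c h i => ?_⟩
    obtain ⟨⟨h₃, h₄⟩, ⟨h₅, h₆⟩, -⟩ := h.invariant hn hm i.castSucc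
    obtain ⟨A, hA, hstep⟩ := h.2.1 i
    rw [hstep]
    refine (h₂ h₃ h₅ A hA).mono ?_
    rw [Polynomial.eval_pow, Polynomial.eval_X]
    -- The step is bounded in the weight of its own instance, which is at most that of the start of
    -- the chain, hence at most the size of the initial formula.
    exact Nat.pow_le_pow_left ((gsWeight_mono h₄ h₆).trans (gsWeight_le_totalSize n m)) k₂
  · exact ⟨_, isQuasipolynomial_pow k, fun n m hn hm => hk hn hm⟩
  · exact fun n hn => ⟨Polynomial.X ^ k, fun m hm => by simpa using hk hn hm⟩
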